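/- **Definitions.** A *preclone* $S$ consists of sets $S_n$ ($n\ge 0$), an element $\mathbf 1\in S_1$ and compositions $S_n\times S_{n,m}\to S_m$, $(f,g)\mapsto f\cdot g$, where $S_{n,m}$ is the set of $n$-tuples $g=g_1\oplus\cdots\oplus g_n$ with $g_i\in S_{m_i}$ and $\sum_i m_i=m$, such that $\mathbf 1\cdot f=f=f\cdot\mathbf n$ for $f\in S_n$ (with $\mathbf n=\mathbf 1\oplus\cdots\oplus\mathbf 1$, $n$ times) and $(f\cdot g)\cdot h=f\cdot(g\cdot h)$ for $f\in S_n$, $g\in S_{n,m}$, $h\in S_{m,p}$, where $g\cdot h=g_1\cdot\bar h_1\oplus\cdots\oplus g_n\cdot\bar h_n$ and $\bar h_1,\dots,\bar h_n$ are the groups of the first $m_1$, the next $m_2$, … entries of $h$. It is *finitary* if every $S_n$ is finite. A *pg-pair* is a pair $(S,A)$ of a preclone and a (ranked) set $A$ generating it; it is finitary if $S$ is finitary and $A$ is finite. $(S,A)$ is a *sub-pg-pair* of $(T,B)$ if $A\subseteq B$ and $S$ is the sub-preclone of $T$ generated by $A$. For a preclone $T$, let $I_{k,n}(T)$ be the set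 of $n$-ary contexts in $T_k$: the tuples $(u,k_1,v,k_2)$ with $u\in T_{k_1+1+k_2}$, $v\in T_{n,\ell}$ and $k_1+\ell+k_2=k$. The *block product* $S\,\Box_k T$ of preclones has $(S\,\Box_k T)_n=S_n^{I_{k,n}(T)}\times T_n$, unit $(F_{\mathbf 1},\mathbf 1)$ with $F_{\mathbf 1}$ constantly $\mathbf 1$, and composition $(F,f)\cdot\bigoplus_{i=1}^n(G_i,g_i)=(Q,f\cdot g)$ with $$Q(u,k_1,v,k_2)=F(u,k_1,g\cdot v,k_2)\cdot\big(G_1(C_1)\oplus\cdots\oplus G_n(C_n)\big),\qquad C_i=(c_i,p_1,\bar v_i,p_2),$$ where $g=\bigoplus_i g_i$, $g\cdot v=\bigoplus_i g_i\cdot\bar v_i$, $\ell_i$ is the total rank of $\bar v_i$, $p_1=k_1+\sum_{j<i}\ell_j$, $p_2=\sum_{j>i}\ell_j+k_2$, and $c_i=u\cdot(\mathbf k_1\oplus f\cdot(g_1\cdot\bar v_1\oplus\cdots\oplus g_{i-1}\cdot\bar v_{i-1}\oplus\mathbf 1\oplus g_{i+1}\cdot\bar v_{i+1}\oplus\cdots\oplus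 g_n\cdot\bar v_n)\oplus\mathbf k_2)$. If $T$ is a sub-preclone of $T'$, then $S\,\Box_k^{T'}T$ is the sub-preclone of $S\,\Box_k T'$ of the elements whose second component is in $T$. For pg-pairs, $(S,A)\,\Box_k(T,B)$ is the sub-preclone of $S\,\Box_k T$ generated by, and taken together with, the pairs $(F,g)$ such that for some $n$, $g\in B_n$ and $F(C)\in A_n$ for all $C\in I_{k,n}(T)$; if $(T,B)$ is a sub-pg-pair of $(T',B')$, then $(S,A)\,\Box_k^{(T',B')}(T,B)$ is the sub-pg-pair of $(S,A)\,\Box_k(T',B')$ generated by those of its generators $(F,g)$ with $g\in B$. A *pseudovariety of preclones* is a class of finitary preclones closed under finite direct products, sub-preclones, quotients, finitary unions of $\omega$-chains and finitary inverse limits of $\omega$-diagrams. A *pseudovariety of pg-pairs* is a class of finitary pg-pairs closed under (non-empty) finite direct products, sub-pg-pairs, quotients and finitary inverse limits of $\omega$-diagrams. (The generators of a product or limit of pg-pairs are the rankwise product or limit of the sets of generators, and its preclone is the one they generate.) A pseudovariety $\mathbf V$ of preclones (of pg-pairs) is *closed* if it contains $X\,\Box_k Y$ for all $X,Y\in\mathbf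 V$ and $k\ge 0$. **Statement.** 1. For all preclones $S,T$ and every $k\ge 0$, $S\,\Box_k T$ satisfies the axioms of preclones. 2. Let $\mathbf V$ be a closed pseudovariety of preclones, let $S,T\in\mathbf V$, and let $T'$ be a finitary preclone of which $T$ is a sub-preclone. Then $S\,\Box_k^{T'}T\in\mathbf V$ for every $k\ge 0$. 3. For all pg-pairs $(S,A),(T,B)$ and every $k\ge 0$, $(S,A)\,\Box_k(T,B)$ is a pg-pair. 4. Let $\mathbf V$ be a closed pseudovariety of pg-pairs, let $(S,A),(T,B)\in\mathbf V$, and let $(T',B')$ be a finitary pg-pair of which $(T,B)$ is a sub-pg-pair. Then $(S,A)\,\Box_k^{(T',B')}(T,B)\in\mathbf V$ for every $k\ge 0$. -/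

import Mathlib

universe u

/-! ## Tuples of ranked elements -/

/-- The set `S_{n,m}` of `n`-tuples `g₁ ⊕ ⋯ ⊕ gₙ` of elements of the ranked set `El`, of total
rank `m`. -/
structure Tup (El : ℕ → Type u) (n m : ℕ) : Type u where
  list : List (Σ r, El r)
  length_eq : list.length = n
  rank_eq : (list.map Sigma.fst).sum = m

namespace Tup

variable {El El' : ℕ → Type u} {n m p n' m' : ℕ}

@[ext] theorem ext {g h : Tup El n m} (e : g.list = h.list) : g = h := by
  cases g; cases h; cases e; rfl

/-- The 1-tuple consisting of `x`. -/
def single {r : ℕ} (x : El r) : Tup El 1 r := ⟨[⟨r, x⟩], rfl, by simp⟩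

/-- The sum `g ⊕ h` of two tuples. -/
def append (g : Tup El n m) (h : Tup El n' m') : Tup El (n + n') (m + m') :=
  ⟨g.list ++ h.list, by simp [g.length_eq, h.length_eq], by simp [g.rank_eq, h.rank_eq]⟩

/-- The same tuple, its total rank being written differently. -/
def cast (e : m = m') (g : Tup El n m) : Tup El n m' := ⟨g.list, g.length_eq, g.rank_eq.trans e⟩

/-- The image of a tuple under a rank preserving map. -/
def map (φ : ∀ r, El r → El' r) (g : Tup El n m) : Tup El' n m :=
  ⟨g.list.map (fun x => ⟨x.1, φ x.1 x.2⟩), by simp [g.length_eq], by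
    rw [List.map_map]; exact g.rank_eq⟩

/-- The `i`-th entry of a tuple, together with its rank. -/
def get (g : Tup El n m) (i : Fin n) : Σ r, El r :=
  g.list[i.1]'(by rw [g.length_eq]; exact i.2)

/-- The sum of the ranks of the entries with index less than `i`. -/
def before (g : Tup El n m) (i : Fin n) : ℕ := ((g.list.take i.1).map Sigma.fst).sum

/-- The sum of the ranks of the entries with index greater than `i`. -/
def after (g : Tup El n m) (i : Fin n) : ℕ := ((g.list.drop (i.1 + 1)).map Sigma.fst).sum

theorem before_add_after (g : Tup El n m) (i : Fin n) :
    g.before i + (g.get i).1 + g.after i = m := by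
  have hi : i.1 < g.list.length := by rw [g.length_eq]; exact i.2
  have h : g.list.take i.1 ++ g.list[i.1] :: g.list.drop (i.1 + 1) = g.list := by
    rw [List.getElem_cons_drop, List.take_append_drop]
  have h2 := congrArg (fun l => (l.map Sigma.fst).sum) h
  simp only [List.map_append, List.map_cons, List.sum_append, List.sum_cons, g.rank_eq] at h2
  simp only [before, after, get]
  omega

/-- The tuple obtained from `g` by replacing the `i`-th entry by `x`. -/
def replace (g : Tup El n m) (i : Fin n) {r : ℕ} (x : El r) :
    Tup El n (g.before i + r + g.after i) :=
  ⟨g.list.set i.1 ⟨r, x⟩, by simp [g.length_eq], by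
    have hi : i.1 < g.list.length := by rw [g.length_eq]; exact i.2
    rw [List.set_eq_take_append_cons_drop, if_pos hi]
    simp [before, after, add_assoc]⟩

/-- If `g` has total rank `m` and `h` is an `m`-tuple, then `h` is the sum of consecutive groups
`h̄₁ ⊕ ⋯ ⊕ h̄ₙ`, where the length of `h̄ᵢ` is the rank of `gᵢ`; this is the list of entries of
the `i`-th group. -/
def groupList (g : Tup El n m) (h : Tup El' m p) (i : Fin n) : List (Σ r, El' r) :=
  ((g.list.map Sigma.fst).splitLengths h.list)[i.1]'(by
    rw [List.length_splitLengths, List.length_map, g.length_eq]; exact i.2)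

theorem length_groupList (g : Tup El n m) (h : Tup El' m p) (i : Fin n) :
    (g.groupList h i).length = (g.get i).1 := by
  unfold groupList get
  rw [List.splitLengths_length_getElem]
  · simp
  · rw [g.rank_eq, h.length_eq]

/-- The total rank `ℓᵢ` of the `i`-th group. -/
def groupRank (g : Tup El n m) (h : Tup El' m p) (i : Fin n) : ℕ :=
  ((g.groupList h i).map Sigma.fst).sum

/-- The `i`-th group `h̄ᵢ`. -/
def group (g : Tup El n m) (h : Tup El' m p) (i : Fin n) :
    Tup El' (g.get i).1 (g.groupRank h i) :=
  ⟨g.groupList h i, g.length_groupList h i, rfl⟩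

theorem sum_groupRank (g : Tup El n m) (h : Tup El' m p) :
    (List.ofFn fun i => g.groupRank h i).sum = p := by
  have hl : ((g.list.map Sigma.fst).splitLengths h.list).length = n := by
    rw [List.length_splitLengths, List.length_map, g.length_eq]
  have h1 : (List.ofFn fun i => g.groupRank h i) =
      ((g.list.map Sigma.fst).splitLengths h.list).map (fun l => (l.map Sigma.fst).sum) := by
    apply List.ext_getElem
    · simp [g.length_eq]
    · intro i _ _
      simp [groupRank, groupList]
  have h2 : ((g.list.map Sigma.fst).splitLengths h.list).flatten = h.list :=
    List.flatten_splitLengths _ _ (by rw [g.rank_eq, h.length_eq])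
  have h3 : ((((g.list.map Sigma.fst).splitLengths h.list).flatten).map Sigma.fst).sum = p := by
    rw [h2, h.rank_eq]
  rw [List.map_flatten, List.sum_flatten, List.map_map] at h3
  rw [h1]
  exact h3

theorem sum_get_fst (g : Tup El n m) : (List.ofFn fun i => (g.get i).1).sum = m := by
  refine Eq.trans (congrArg List.sum ?_) g.rank_eq
  apply List.ext_getElem
  · simp [g.length_eq]
  · intro i _ _
    simp [get]

end Tup

/-! ## Preclones -/

/-- The signature of preclones: a ranked set with an element `𝟏` of rank 1 and a composition
`f · (g₁ ⊕ ⋯ ⊕ gₙ)`. The axioms are in `PrecloneData.IsPreclone`. -/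
structure PrecloneData where
  El : ℕ → Type u
  one : El 1
  comp : ∀ {n m : ℕ}, El n → Tup El n m → El m

namespace PrecloneData

/-- The tuple `𝐧`, the sum of `n` copies of `𝟏`. -/
def ones (S : PrecloneData.{u}) (n : ℕ) : Tup S.El n n :=
  ⟨List.replicate n ⟨1, S.one⟩, by simp, by simp⟩

/-- The tuple `g · h = g₁ · h̄₁ ⊕ ⋯ ⊕ gₙ · h̄ₙ`. -/
def tupComp (S : PrecloneData.{u}) {n m p : ℕ} (g : Tup S.El n m) (h : Tup S.El m p) :
    Tup S.El n p :=
  ⟨List.ofFn fun i => ⟨g.groupRank h i, S.comp (g.get i).2 (g.group h i)⟩, by simp, by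
    rw [List.map_ofFn]; exact g.sum_groupRank h⟩

/-- The axioms of preclones. -/
structure IsPreclone (S : PrecloneData.{u}) : Prop where
  one_comp : ∀ {n : ℕ} (f : S.El n), S.comp S.one (Tup.single f) = f
  comp_ones : ∀ {n : ℕ} (f : S.El n), S.comp f (S.ones n) = f
  assoc : ∀ {n m p : ℕ} (f : S.El n) (g : Tup S.El n m) (h : Tup S.El m p),
    S.comp (S.comp f g) h = S.comp f (S.tupComp g h)

/-- Every set of elements of a given rank is finite. -/
def IsFinitary (S : PrecloneData.{u}) : Prop := ∀ n, Finite (S.El n)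

end PrecloneData

/-- Morphisms of preclones. -/
structure PrecloneHom (S T : PrecloneData.{u}) where
  toFun : ∀ n, S.El n → T.El n
  map_one : toFun 1 S.one = T.one
  map_comp : ∀ {n m : ℕ} (f : S.El n) (g : Tup S.El n m),
    toFun m (S.comp f g) = T.comp (toFun n f) (g.map toFun)

/-- Sub-preclones. -/
structure SubPreclone (S : PrecloneData.{u}) where
  carrier : ∀ n, Set (S.El n)
  one_mem : S.one ∈ carrier 1
  comp_mem : ∀ {n m : ℕ} (f : S.El n) (g : Tup S.El n m), f ∈ carrier n →
    (∀ x ∈ g.list, x.2 ∈ carrier x.1) → S.comp f g ∈ carrier m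

namespace SubPreclone

/-- A sub-preclone, as a preclone in its own right. -/
def toPreclone {S : PrecloneData.{u}} (B : SubPreclone S) : PrecloneData.{u} where
  El n := B.carrier n
  one := ⟨S.one, B.one_mem⟩
  comp f g := ⟨S.comp f.1 (g.map fun _ x => x.1), B.comp_mem _ _ f.2 (by
    intro x hx
    obtain ⟨y, _, rfl⟩ := List.mem_map.1 hx
    exact y.2.2)⟩

/-- The least sub-preclone containing the ranked set `A`. -/
def generated (S : PrecloneData.{u}) (A : ∀ n, Set (S.El n)) : SubPreclone S where
  carrier n := {x | ∀ B : SubPreclone S, (∀ r, A r ⊆ B.carrier r) → x ∈ B.carrier n}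
  one_mem B _ := B.one_mem
  comp_mem f g hf hg B hB := B.comp_mem f g (hf B hB) fun x hx => hg x hx B hB

end SubPreclone

namespace PrecloneData

/-- Direct products. -/
def pi {ι : Type} (P : ι → PrecloneData.{u}) : PrecloneData.{u} where
  El n := ∀ i, (P i).El n
  one i := (P i).one
  comp f g i := (P i).comp (f i) (g.map fun _ x => x i)

/-- The inverse limit of an `ω`-diagram `φⱼ : P (j + 1) → P j`. -/
def limit (P : ℕ → PrecloneData.{u}) (φ : ∀ j, PrecloneHom (P (j + 1)) (P j)) :
    SubPreclone (pi P) where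
  carrier n := {x | ∀ j, (φ j).toFun n (x (j + 1)) = x j}
  one_mem j := (φ j).map_one
  comp_mem f g hf hg j := by
    change (φ j).toFun _ ((P (j + 1)).comp _ _) = (P j).comp _ _
    rw [(φ j).map_comp, hf j]
    congr 1
    ext1
    simp only [Tup.map, List.map_map]
    apply List.map_congr_left
    intro x hx
    simp only [Function.comp]
    rw [hg x hx j]

/-- The set `I_{k,n}` of `n`-ary contexts in `T_k`: tuples `(u, k₁, v, k₂)` with
`u ∈ T_{k₁+1+k₂}`, `v ∈ T_{n,ℓ}` and `k₁ + ℓ + k₂ = k`. -/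
structure Context (T : PrecloneData.{u}) (k n : ℕ) where
  k₁ : ℕ
  ℓ : ℕ
  k₂ : ℕ
  rank_eq : k₁ + ℓ + k₂ = k
  u : T.El (k₁ + 1 + k₂)
  v : Tup T.El n ℓ

/-- The set `S_n^{I_{k,n}} × T_n` of rank `n` elements of the `k`-th block product. -/
abbrev BlockEl (S T : PrecloneData.{u}) (k n : ℕ) : Type u := (Context T k n → S.El n) × T.El n

variable {S T : PrecloneData.{u}} {k n m : ℕ}

/-- The context `(u, k₁, g · v, k₂)`. -/
def Context.absorb (C : Context T k m) (g : Tup T.El n m) : Context T k n where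
  k₁ := C.k₁
  ℓ := C.ℓ
  k₂ := C.k₂
  rank_eq := C.rank_eq
  u := C.u
  v := T.tupComp g C.v

theorem tupComp_get_fst (G : Tup (BlockEl S T k) n m) {p : ℕ} (v : Tup T.El m p) (i : Fin n) :
    ((T.tupComp (G.map fun _ x => x.2) v).get i).1 = G.groupRank v i := by
  simp [tupComp, Tup.get, Tup.groupRank, Tup.groupList, Tup.map, Function.comp_def]

/-- The context `Cᵢ = (cᵢ, p₁, v̄ᵢ, p₂)`, where
`cᵢ = u · (𝐤₁ ⊕ f · (g₁ · v̄₁ ⊕ ⋯ ⊕ gᵢ₋₁ · v̄ᵢ₋₁ ⊕ 𝟏 ⊕ gᵢ₊₁ · v̄ᵢ₊₁ ⊕ ⋯ ⊕ gₙ · v̄ₙ) ⊕ 𝐤₂)`,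
`p₁ = k₁ + ∑_{j<i} ℓⱼ` and `p₂ = ∑_{j>i} ℓⱼ + k₂`. -/
def Context.inner (C : Context T k m) (f : T.El n) (G : Tup (BlockEl S T k) n m) (i : Fin n) :
    Context T k (G.get i).1 :=
  let w := T.tupComp (G.map fun _ x => x.2) C.v
  { k₁ := C.k₁ + w.before i
    ℓ := G.groupRank C.v i
    k₂ := w.after i + C.k₂
    rank_eq := by
      have h := w.before_add_after i
      have h1 : (w.get i).1 = G.groupRank C.v i := tupComp_get_fst G C.v i
      have h2 := C.rank_eq
      omega
    u := T.comp C.u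
      ((((T.ones C.k₁).append (Tup.single (T.comp f (w.replace i T.one)))).append
        (T.ones C.k₂)).cast (by omega))
    v := G.group C.v i }

/-- The block product `S □_k T`. -/
def block (S T : PrecloneData.{u}) (k : ℕ) : PrecloneData.{u} where
  El := BlockEl S T k
  one := (fun _ => S.one, T.one)
  comp := fun {n m} F G =>
    (fun C => S.comp (F.1 (C.absorb (G.map fun _ x => x.2)))
      (⟨List.ofFn fun i : Fin n => ⟨(G.get i).1, (G.get i).2.1 (C.inner F.2 G i)⟩, by simp, by
        rw [List.map_ofFn]; exact G.sum_get_fst⟩ : Tup S.El n m),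
      T.comp F.2 (G.map fun _ x => x.2))

/-- The restricted block product `S □_k^{T'} T`, for a sub-preclone `T` of `T'`: the sub-preclone
of `S □_k T'` of those elements whose second component belongs to `T`. -/
def restrictedBlock (S T' : PrecloneData.{u}) (T : SubPreclone T') (k : ℕ) :
    SubPreclone (block S T' k) where
  carrier n := {x | x.2 ∈ T.carrier n}
  one_mem := T.one_mem
  comp_mem f g hf hg := T.comp_mem _ _ hf (by
    intro x hx
    obtain ⟨y, hy, rfl⟩ := List.mem_map.1 hx
    exact hg y hy)

end PrecloneData

/-! ## Pseudovarieties of preclones -/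

/-- Pseudovarieties of preclones. Only direct products of non-empty finite families are required to
belong to `V`, so that nothing depends on a convention about the empty product. -/
structure IsPseudovariety (V : Set PrecloneData.{u}) : Prop where
  isPreclone : ∀ S ∈ V, S.IsPreclone
  isFinitary : ∀ S ∈ V, S.IsFinitary
  pi_mem : ∀ (ι : Type) [Finite ι] [Nonempty ι] (P : ι → PrecloneData.{u}),
    (∀ i, P i ∈ V) → PrecloneData.pi P ∈ V
  sub_mem : ∀ S ∈ V, ∀ B : SubPreclone S, B.toPreclone ∈ V
  quotient_mem : ∀ S ∈ V, ∀ T : PrecloneData.{u}, T.IsPreclone → ∀ φ : PrecloneHom S T,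
    (∀ n, Function.Surjective (φ.toFun n)) → T ∈ V
  union_mem : ∀ T : PrecloneData.{u}, T.IsPreclone → T.IsFinitary → ∀ B : ℕ → SubPreclone T,
    (∀ j n, (B j).carrier n ⊆ (B (j + 1)).carrier n) → (∀ n x, ∃ j, x ∈ (B j).carrier n) →
    (∀ j, (B j).toPreclone ∈ V) → T ∈ V
  limit_mem : ∀ (P : ℕ → PrecloneData.{u}) (φ : ∀ j, PrecloneHom (P (j + 1)) (P j)),
    (∀ j, P j ∈ V) → (PrecloneData.limit P φ).toPreclone.IsFinitary →
    (PrecloneData.limit P φ).toPreclone ∈ V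

/-- Closed pseudovarieties of preclones. -/
structure IsClosedPseudovariety (V : Set PrecloneData.{u}) : Prop extends IsPseudovariety V where
  block_mem : ∀ S ∈ V, ∀ T ∈ V, ∀ k : ℕ, S.block T k ∈ V

/-! ## Preclone-generator pairs -/

/-- The data of a `pg`-pair `(S, A)`; the requirements are in `PGData.IsPGPair`. -/
structure PGData where
  S : PrecloneData.{u}
  A : ∀ n, Set (S.El n)

namespace PGData

/-- `S` is a preclone and `A` generates it. -/
def IsPGPair (P : PGData.{u}) : Prop :=
  P.S.IsPreclone ∧ ∀ n x, x ∈ (SubPreclone.generated P.S P.A).carrier n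

/-- `S` is finitary and `A` is finite. -/
def IsFinitary (P : PGData.{u}) : Prop :=
  P.S.IsFinitary ∧ {x : Σ n, P.S.El n | x.2 ∈ P.A x.1}.Finite

/-- The `pg`-pair `(⟨A⟩, A)`, where `⟨A⟩` is the sub-preclone of `S` generated by `A`. -/
def generated (S : PrecloneData.{u}) (A : ∀ n, Set (S.El n)) : PGData.{u} where
  S := (SubPreclone.generated S A).toPreclone
  A n := {x | x.1 ∈ A n}

/-- Direct products: the generators are the tuples of generators of equal rank. -/
def pi {ι : Type} (P : ι → PGData.{u}) : PGData.{u} :=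
  generated (PrecloneData.pi fun i => (P i).S) fun n => {x | ∀ i, x i ∈ (P i).A n}

/-- The inverse limit of an `ω`-diagram of `pg`-pairs: its set of generators is the inverse limit
of the sets of generators. -/
def limit (P : ℕ → PGData.{u}) (φ : ∀ j, PrecloneHom (P (j + 1)).S (P j).S) : PGData.{u} :=
  generated (PrecloneData.limit (fun j => (P j).S) φ).toPreclone
    fun n => {x | ∀ j, x.1 j ∈ (P j).A n}

/-- The pairs `(F, g)` with `g ∈ B_n` and `F(C) ∈ A_n` for each context `C ∈ I_{k,n}`. -/
def blockGen (P : PGData.{u}) (T : PrecloneData.{u}) (B : ∀ n, Set (T.El n)) (k n : ℕ) :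
    Set ((P.S.block T k).El n) :=
  {x | x.2 ∈ B n ∧ ∀ C, x.1 C ∈ P.A n}

/-- The block product `(S, A) □_k (T, B)`. -/
def block (P Q : PGData.{u}) (k : ℕ) : PGData.{u} :=
  generated (P.S.block Q.S k) (P.blockGen Q.S Q.A k)

/-- The restricted block product `(S, A) □_k^{(T', B')} (T, B)`, where `(T, B)` is the
sub-`pg`-pair of `(T', B')` generated by `B ⊆ B'`: the sub-`pg`-pair of `(S, A) □_k (T', B')` whose
generators are those `(F, g)` with `g ∈ B`. -/
def restrictedBlock (P Q' : PGData.{u}) (B : ∀ n, Set (Q'.S.El n)) (k : ℕ) : PGData.{u} :=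
  generated (P.block Q' k).S fun n => {x | x ∈ (P.block Q' k).A n ∧ x.1.2 ∈ B n}

end PGData

/-- Pseudovarieties of `pg`-pairs. (The product of the empty family has a generator of each rank,
so it is not finitary.) -/
structure IsPGPseudovariety (V : Set PGData.{u}) : Prop where
  isPGPair : ∀ P ∈ V, P.IsPGPair
  isFinitary : ∀ P ∈ V, P.IsFinitary
  pi_mem : ∀ (ι : Type) [Finite ι] [Nonempty ι] (P : ι → PGData.{u}),
    (∀ i, P i ∈ V) → PGData.pi P ∈ V
  sub_mem : ∀ P ∈ V, ∀ A : ∀ n, Set (P.S.El n), (∀ n, A n ⊆ P.A n) → PGData.generated P.S A ∈ V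
  quotient_mem : ∀ P ∈ V, ∀ Q : PGData.{u}, Q.IsPGPair → ∀ φ : PrecloneHom P.S Q.S,
    (∀ n, φ.toFun n '' P.A n = Q.A n) → Q ∈ V
  limit_mem : ∀ (P : ℕ → PGData.{u}) (φ : ∀ j, PrecloneHom (P (j + 1)).S (P j).S),
    (∀ j n, (φ j).toFun n '' (P (j + 1)).A n ⊆ (P j).A n) → (∀ j, P j ∈ V) →
    (PGData.limit P φ).IsFinitary → PGData.limit P φ ∈ V

/-- Closed pseudovarieties of `pg`-pairs. -/
structure IsClosedPGPseudovariety (V : Set PGData.{u}) : Prop extends IsPGPseudovariety V where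
  block_mem : ∀ P ∈ V, ∀ Q ∈ V, ∀ k : ℕ, P.block Q k ∈ V

/-! The block product and its restricted version.

Associativity in `S □_k T` reduces to associativity in `S` once the contexts at which the components
of `F`, `G` and `H` are evaluated agree for the two bracketings of `F · G · H`. These are the
identities `Context.absorb_absorb`, `Context.raw_inner_absorb` and `Context.raw_inner_inner`; they
follow from associativity in `T`. To avoid transports along equalities of ranks, the computations are
made with lists of elements of arbitrary rank (`scomp`, `lcomp`), and contexts are compared through
their components `Context.raw`.

For the restricted block products, the point is that contexts can be composed: a context
`D ∈ I_{m,n}(T)` plugged into `C ∈ I_{k,m}(T')` gives `C ∘ D ∈ I_{k,n}(T')` (`Context.plug`). As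
plugging into `C` commutes with the two operations on contexts in the definition of the composition
(`Context.plug_absorb`, `Context.raw_plug_inner`), the map `(F, g) ↦ (F(C ∘ _), g)` is a morphism
from `S □_k^{T'} T` to `S □_m T` (`restrictedBlockHom`), whose target involves no context over `T'`.
Plugging the identity context into `C` gives `C`, so these morphisms, for all `m` and
`C ∈ I_{k,m}(T')`, separate the elements of `S □_k^{T'} T`. There are countably many of them, `T'`
being finitary. Finally, a finitary preclone `X` that is separated by countably many morphisms
`ψ₀, ψ₁, …` to members of a pseudovariety is itself a member
(`IsPseudovariety.mem_of_separating`): its images under `(ψ₀, …, ψⱼ)` form an `ω`-diagram of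
sub-preclones of finite products, and `X` is the limit of this diagram, because at each rank the
diagram is eventually constant with value `X`. The same argument applies to `pg`-pairs, since
the morphisms in question take generators to generators.
-/

/-! ### Composition of untyped lists of ranked elements -/

/-- The total rank of a list of ranked elements. -/
def totalRank {El : ℕ → Type u} (L : List (Σ r, El r)) : ℕ := (L.map Sigma.fst).sum

section totalRank

variable {El : ℕ → Type u}

@[simp] theorem totalRank_nil : totalRank ([] : List (Σ r, El r)) = 0 := rfl

@[simp] theorem totalRank_cons (x : Σ r, El r) (L : List (Σ r, El r)) :
    totalRank (x :: L) = x.1 + totalRank L := rfl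

@[simp] theorem totalRank_append (K L : List (Σ r, El r)) :
    totalRank (K ++ L) = totalRank K + totalRank L := by
  simp [totalRank]

@[simp] theorem totalRank_replicate (n : ℕ) (x : Σ r, El r) :
    totalRank (List.replicate n x) = n * x.1 := by
  simp [totalRank]

end totalRank

/-- The map on elements of arbitrary rank induced by a rank preserving map. -/
abbrev sigmaMap {El El' : ℕ → Type u} (φ : ∀ r, El r → El' r) (x : Σ r, El r) : Σ r, El' r :=
  ⟨x.1, φ x.1 x.2⟩

@[simp] theorem totalRank_map {El El' : ℕ → Type u} (φ : ∀ r, El r → El' r)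
    (L : List (Σ r, El r)) : totalRank (L.map (sigmaMap φ)) = totalRank L := by
  simp [totalRank, Function.comp_def]

theorem Tup.totalRank_eq {El : ℕ → Type u} {n m : ℕ} (g : Tup El n m) : totalRank g.list = m :=
  g.rank_eq

theorem Tup.map_list {El El' : ℕ → Type u} {n m : ℕ} (φ : ∀ r, El r → El' r) (g : Tup El n m) :
    (g.map φ).list = g.list.map (sigmaMap φ) := rfl

theorem Tup.map_map {El El' El'' : ℕ → Type u} {n m : ℕ} (φ : ∀ r, El r → El' r)
    (ψ : ∀ r, El' r → El'' r) (g : Tup El n m) :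
    (g.map φ).map ψ = g.map fun r x => ψ r (φ r x) := by
  ext1
  simp [Tup.map_list, Function.comp_def]

theorem Tup.map_id {El : ℕ → Type u} {n m : ℕ} (g : Tup El n m) : (g.map fun _ x => x) = g := by
  ext1
  simp [Tup.map_list]

theorem Tup.map_congr {El El' : ℕ → Type u} {n m : ℕ} {φ ψ : ∀ r, El r → El' r} {g : Tup El n m}
    (h : ∀ x ∈ g.list, φ x.1 x.2 = ψ x.1 x.2) : g.map φ = g.map ψ := by
  ext1
  exact List.map_congr_left fun x hx => by rw [h x hx]

/-- An entry of a tuple, read off from a decomposition of an image of the tuple. -/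
theorem Tup.get_eq_of_map_list_eq {El El' : ℕ → Type u} {n m : ℕ} (φ : ∀ r, El r → El' r)
    (G : Tup El n m) (i : Fin n) {gl gr : List (Σ r, El' r)} {x : Σ r, El' r}
    (hG : G.list.map (sigmaMap φ) = gl ++ x :: gr) (hi : gl.length = i) :
    sigmaMap φ (G.get i) = x ∧ G.before i = totalRank gl := by
  have h1 : (G.list.map (sigmaMap φ))[i.1]? = some x := by
    rw [hG, ← hi]; simp
  rw [List.getElem?_map, List.getElem?_eq_getElem (by rw [G.length_eq]; exact i.2)] at h1
  have h2 := congrArg (fun L => totalRank (L.take i.1)) hG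
  simp only [← List.map_take, totalRank_map] at h2
  rw [← hi, List.take_left' rfl, hi] at h2
  exact ⟨Option.some.inj h1, h2⟩

theorem List.exists_eq_append_append {α : Type*} (v : List α) {a b c : ℕ}
    (h : v.length = a + (b + c)) :
    ∃ vl vm vr, v = vl ++ (vm ++ vr) ∧ vl.length = a ∧ vm.length = b ∧ vr.length = c :=
  ⟨v.take a, (v.drop a).take b, (v.drop a).drop b, by simp only [List.take_append_drop],
    by simp; omega, by simp; omega, by simp; omega⟩

theorem List.getElem_splitLengths {α : Type*} (sz : List ℕ) (l : List α) (i : ℕ)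
    (hi : i < sz.length) :
    (sz.splitLengths l)[i]'(by simpa using hi) = (l.drop (sz.take i).sum).take sz[i] := by
  induction sz generalizing l i with
  | nil => simp at hi
  | cons a sz ih =>
    cases i with
    | zero => simp
    | succ i =>
      simp only [List.splitLengths_cons, List.getElem_cons_succ, List.take_succ_cons,
        List.sum_cons]
      rw [ih _ _ (by simpa using hi), List.drop_drop]

theorem Tup.groupList_eq {El El' : ℕ → Type u} {n m p : ℕ} (g : Tup El n m) (h : Tup El' m p)
    (i : Fin n) : g.groupList h i = (h.list.drop (g.before i)).take (g.get i).1 := by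
  unfold Tup.groupList
  rw [List.getElem_splitLengths _ _ _ (by simp [g.length_eq])]
  simp [Tup.before, Tup.get, List.map_take]

namespace PrecloneData

variable {S : PrecloneData.{u}}

/-- The composition `x · L` for elements of arbitrary rank. It is `x` if the length of `L` is not
the rank of `x`. -/
def scomp (S : PrecloneData.{u}) (x : Σ r, S.El r) (L : List (Σ r, S.El r)) : Σ r, S.El r :=
  if h : L.length = x.1 then ⟨totalRank L, S.comp x.2 ⟨L, h, rfl⟩⟩ else x

/-- The composition `G · H` of lists: the elements of `G` are composed with consecutive groups of
entries of `H`. -/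
def lcomp (S : PrecloneData.{u}) :
    List (Σ r, S.El r) → List (Σ r, S.El r) → List (Σ r, S.El r)
  | [], _ => []
  | x :: G, H => S.scomp x (H.take x.1) :: lcomp S G (H.drop x.1)

/-- The unit, as an element of arbitrary rank. -/
abbrev sone (S : PrecloneData.{u}) : Σ r, S.El r := ⟨1, S.one⟩

theorem scomp_mk {n m : ℕ} (f : S.El n) (g : Tup S.El n m) :
    S.scomp ⟨n, f⟩ g.list = ⟨m, S.comp f g⟩ := by
  obtain ⟨L, h, rfl⟩ := g
  simp [scomp, h, totalRank]

theorem scomp_fst {x : Σ r, S.El r} {L : List (Σ r, S.El r)} (h : L.length = x.1) :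
    (S.scomp x L).1 = totalRank L := by
  simp [scomp, h]

@[simp] theorem lcomp_nil (H : List (Σ r, S.El r)) : S.lcomp [] H = [] := rfl

theorem lcomp_cons (x : Σ r, S.El r) (G H : List (Σ r, S.El r)) :
    S.lcomp (x :: G) H = S.scomp x (H.take x.1) :: S.lcomp G (H.drop x.1) := rfl

@[simp] theorem length_lcomp (G H : List (Σ r, S.El r)) :
    (S.lcomp G H).length = G.length := by
  induction G generalizing H with
  | nil => rfl
  | cons x G ih => simp [lcomp_cons, ih]

theorem totalRank_lcomp {G H : List (Σ r, S.El r)} (h : H.length = totalRank G) :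
    totalRank (S.lcomp G H) = totalRank H := by
  induction G generalizing H with
  | nil => simp_all
  | cons x G ih =>
    simp only [totalRank_cons] at h
    rw [lcomp_cons, totalRank_cons, scomp_fst (by simp; omega), ih (by simp; omega),
      ← totalRank_append, List.take_append_drop]

theorem getElem_lcomp (G H : List (Σ r, S.El r)) (i : ℕ) (hi : i < G.length) :
    (S.lcomp G H)[i]'(by simpa using hi) =
      S.scomp G[i] ((H.drop (totalRank (G.take i))).take G[i].1) := by
  induction G generalizing H i with
  | nil => simp at hi
  | cons x G ih =>
    cases i with
    | zero => simp [lcomp_cons]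
    | succ i =>
      simp only [lcomp_cons, List.getElem_cons_succ, List.take_succ_cons, totalRank_cons]
      rw [ih _ _ (by simpa using hi), List.drop_drop]

theorem tupComp_list {n m p : ℕ} (g : Tup S.El n m) (h : Tup S.El m p) :
    (S.tupComp g h).list = S.lcomp g.list h.list := by
  apply List.ext_getElem
  · simp [tupComp, g.length_eq]
  · intro i h1 h2
    have hi : i < n := by simpa [tupComp] using h1
    rw [getElem_lcomp _ _ _ (by rwa [g.length_eq])]
    simp only [tupComp, List.getElem_ofFn]
    have := g.groupList_eq h ⟨i, hi⟩
    simp only [Tup.before, Tup.get] at this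
    rw [← scomp_mk]
    exact congrArg (S.scomp _) this

theorem lcomp_append {G₁ G₂ H₁ H₂ : List (Σ r, S.El r)} (h : H₁.length = totalRank G₁) :
    S.lcomp (G₁ ++ G₂) (H₁ ++ H₂) = S.lcomp G₁ H₁ ++ S.lcomp G₂ H₂ := by
  induction G₁ generalizing H₁ with
  | nil => simp_all
  | cons x G ih =>
    simp only [totalRank_cons] at h
    simp only [List.cons_append, lcomp_cons]
    rw [List.take_append_of_le_length (by omega), List.drop_append_of_le_length (by omega),
      ih (by simp; omega)]

theorem lcomp_cons_append {x : Σ r, S.El r} {G H₁ H₂ : List (Σ r, S.El r)}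
    (h : H₁.length = x.1) :
    S.lcomp (x :: G) (H₁ ++ H₂) = S.scomp x H₁ :: S.lcomp G H₂ := by
  simp [lcomp_cons, ← h]

theorem IsPreclone.scomp_scomp (hS : S.IsPreclone) {x : Σ r, S.El r} {G H : List (Σ r, S.El r)}
    (hG : G.length = x.1) (hH : H.length = totalRank G) :
    S.scomp (S.scomp x G) H = S.scomp x (S.lcomp G H) := by
  obtain ⟨n, f⟩ := x
  let g : Tup S.El n (totalRank G) := ⟨G, hG, rfl⟩
  let h : Tup S.El (totalRank G) (totalRank H) := ⟨H, hH, rfl⟩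
  change S.scomp (S.scomp ⟨n, f⟩ g.list) h.list = S.scomp _ (S.lcomp g.list h.list)
  rw [← tupComp_list, scomp_mk, scomp_mk, scomp_mk, hS.assoc]

theorem IsPreclone.lcomp_lcomp (hS : S.IsPreclone) {G H K : List (Σ r, S.El r)}
    (hH : H.length = totalRank G) (hK : K.length = totalRank H) :
    S.lcomp (S.lcomp G H) K = S.lcomp G (S.lcomp H K) := by
  induction G generalizing H K with
  | nil => rfl
  | cons x G ih =>
    simp only [totalRank_cons] at hH
    obtain ⟨H₁, H₂, rfl, h1⟩ : ∃ H₁ H₂, H = H₁ ++ H₂ ∧ H₁.length = x.1 :=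
      ⟨H.take x.1, H.drop x.1, by simp, by simp; omega⟩
    simp only [totalRank_append, List.length_append] at hK hH
    obtain ⟨K₁, K₂, rfl, h2⟩ : ∃ K₁ K₂, K = K₁ ++ K₂ ∧ K₁.length = totalRank H₁ :=
      ⟨K.take (totalRank H₁), K.drop (totalRank H₁), by simp, by simp; omega⟩
    simp only [List.length_append] at hK
    rw [lcomp_cons_append h1, lcomp_append h2, lcomp_cons_append (by rw [scomp_fst h1, h2]),
      lcomp_cons_append (by simpa using h1), ih (by omega) (by omega), hS.scomp_scomp h1 h2]

theorem IsPreclone.sone_scomp (hS : S.IsPreclone) (x : Σ r, S.El r) :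
    S.scomp S.sone [x] = x := by
  obtain ⟨n, f⟩ := x
  exact (scomp_mk S.one (Tup.single f)).trans (by rw [hS.one_comp])

theorem IsPreclone.scomp_replicate (hS : S.IsPreclone) (x : Σ r, S.El r) :
    S.scomp x (List.replicate x.1 S.sone) = x := by
  obtain ⟨n, f⟩ := x
  exact (scomp_mk f (S.ones n)).trans (by rw [hS.comp_ones])

theorem IsPreclone.lcomp_replicate (hS : S.IsPreclone) (G : List (Σ r, S.El r)) {n : ℕ}
    (h : n = totalRank G) : S.lcomp G (List.replicate n S.sone) = G := by
  subst h
  induction G with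
  | nil => rfl
  | cons x G ih =>
    rw [totalRank_cons, List.replicate_add, lcomp_cons_append (by simp), ih, hS.scomp_replicate]

theorem IsPreclone.replicate_lcomp (hS : S.IsPreclone) (H : List (Σ r, S.El r)) {n : ℕ}
    (h : n = H.length) : S.lcomp (List.replicate n S.sone) H = H := by
  subst h
  induction H with
  | nil => rfl
  | cons x H ih =>
    rw [List.length_cons, List.replicate_succ, lcomp_cons]
    simp [ih, hS.sone_scomp]

end PrecloneData

namespace PrecloneHom

variable {S T : PrecloneData.{u}} (φ : PrecloneHom S T)

theorem sigmaMap_scomp (x : Σ r, S.El r) (L : List (Σ r, S.El r)) :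
    sigmaMap φ.toFun (S.scomp x L) = T.scomp (sigmaMap φ.toFun x) (L.map (sigmaMap φ.toFun)) := by
  by_cases h : L.length = x.1
  · obtain ⟨n, f⟩ := x
    let g : Tup S.El n (totalRank L) := ⟨L, h, rfl⟩
    change sigmaMap φ.toFun (S.scomp ⟨n, f⟩ g.list) = T.scomp ⟨n, φ.toFun n f⟩ (g.map φ.toFun).list
    rw [PrecloneData.scomp_mk, PrecloneData.scomp_mk, ← φ.map_comp]
  · simp [PrecloneData.scomp, h]

theorem map_lcomp (G H : List (Σ r, S.El r)) :
    (S.lcomp G H).map (sigmaMap φ.toFun) =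
      T.lcomp (G.map (sigmaMap φ.toFun)) (H.map (sigmaMap φ.toFun)) := by
  induction G generalizing H with
  | nil => rfl
  | cons x G ih =>
    simp only [PrecloneData.lcomp_cons, List.map_cons, ih, φ.sigmaMap_scomp, List.map_take,
      List.map_drop]

theorem map_tupComp {n m p : ℕ} (g : Tup S.El n m) (h : Tup S.El m p) :
    (S.tupComp g h).map φ.toFun = T.tupComp (g.map φ.toFun) (h.map φ.toFun) := by
  ext1
  simp only [Tup.map_list, PrecloneData.tupComp_list, map_lcomp]

theorem map_ones (n : ℕ) : (S.ones n).map φ.toFun = T.ones n := by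
  ext1
  simp [Tup.map_list, PrecloneData.ones, φ.map_one]

/-- The axioms of preclones can be verified after an injective morphism. -/
theorem isPreclone_of_injective (hφ : ∀ n, Function.Injective (φ.toFun n)) (hT : T.IsPreclone) :
    S.IsPreclone where
  one_comp f := hφ _ (by
    rw [φ.map_comp, φ.map_one]
    exact hT.one_comp _)
  comp_ones f := hφ _ (by rw [φ.map_comp, map_ones, hT.comp_ones])
  assoc f g h := hφ _ (by simp only [φ.map_comp, map_tupComp, hT.assoc])

end PrecloneHom

/-! ### Contexts -/

namespace PrecloneData

variable {S T : PrecloneData.{u}} {k n m p : ℕ}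

/-- If `v` is as long as the total rank of `G`, then splitting off the entry of `G` with index `i`
splits `v` into the entries before, in, and after the group that belongs to this entry. -/
theorem exists_split {α : Type*} {El : ℕ → Type u} (G : List (Σ r, El r)) (v : List α)
    (h : v.length = totalRank G) (i : ℕ) (hi : i < G.length) :
    ∃ gl x gr vl vm vr, G = gl ++ x :: gr ∧ gl.length = i ∧ v = vl ++ (vm ++ vr) ∧
      vl.length = totalRank gl ∧ vm.length = x.1 ∧ vr.length = totalRank gr := by
  have hG : G = G.take i ++ G[i] :: G.drop (i + 1) := by
    rw [List.getElem_cons_drop, List.take_append_drop]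
  have hr := congrArg totalRank hG
  simp only [totalRank_append, totalRank_cons] at hr
  obtain ⟨vl, vm, vr, hv, hl, hm, hr'⟩ := v.exists_eq_append_append (h.trans hr)
  exact ⟨G.take i, G[i], G.drop (i + 1), vl, vm, vr, hG, by simp; omega, hv, hl, hm, hr'⟩

/-- The composition `u · (𝐤₁ ⊕ z ⊕ 𝐤₂)`. -/
def insert (T : PrecloneData.{u}) (k₁ k₂ : ℕ) (u z : Σ r, T.El r) : Σ r, T.El r :=
  T.scomp u (List.replicate k₁ T.sone ++ z :: List.replicate k₂ T.sone)

/-- Filling the hole in `t · (v₁ ⊕ ⋯ ⊕ 𝟏 ⊕ ⋯ ⊕ vₙ)`. -/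
theorem IsPreclone.insert_scomp (hT : T.IsPreclone) {t : Σ r, T.El r}
    {vl vr : List (Σ r, T.El r)} (h : vl.length + 1 + vr.length = t.1) (z : Σ r, T.El r) :
    T.insert (totalRank vl) (totalRank vr) (T.scomp t (vl ++ T.sone :: vr)) z =
      T.scomp t (vl ++ z :: vr) := by
  rw [insert, hT.scomp_scomp (by simp; omega) (by simp; omega), lcomp_append (by simp),
    ← List.singleton_append (l := List.replicate _ _), lcomp_cons_append (by simp),
    hT.lcomp_replicate _ rfl, hT.lcomp_replicate _ rfl, hT.sone_scomp]

/-- Inserting into an insertion: the composition of the contexts `u · (𝐤₁ ⊕ _ ⊕ 𝐤₂)` and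
`t · (v₁ ⊕ ⋯ ⊕ _ ⊕ ⋯ ⊕ vₙ)`. -/
theorem IsPreclone.insert_insert (hT : T.IsPreclone) {k₁ k₂ : ℕ} {u t : Σ r, T.El r}
    (hu : u.1 = k₁ + 1 + k₂) {vl vr : List (Σ r, T.El r)} (h : vl.length + 1 + vr.length = t.1)
    (z : Σ r, T.El r) :
    T.insert (k₁ + totalRank vl) (totalRank vr + k₂)
        (T.insert k₁ k₂ u (T.scomp t (vl ++ T.sone :: vr))) z =
      T.insert k₁ k₂ u (T.scomp t (vl ++ z :: vr)) := by
  have h1 : (T.scomp t (vl ++ T.sone :: vr)).1 = totalRank vl + 1 + totalRank vr := by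
    rw [scomp_fst (by simp; omega)]
    simp; omega
  have h2 : List.replicate (k₁ + totalRank vl) T.sone ++
      z :: List.replicate (totalRank vr + k₂) T.sone = List.replicate k₁ T.sone ++
        ((List.replicate (totalRank vl) T.sone ++ z :: List.replicate (totalRank vr) T.sone) ++
          List.replicate k₂ T.sone) := by
    simp only [List.replicate_add, List.append_assoc, List.cons_append]
  rw [← hT.insert_scomp h z]
  conv_lhs => rw [insert, insert]
  rw [hT.scomp_scomp (by simp; omega) (by simp [h1]; omega), h2, lcomp_append (by simp),
    lcomp_cons_append (by simp [h1]; omega), hT.lcomp_replicate _ (by simp),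
    hT.lcomp_replicate _ (by simp)]
  rfl

namespace Context

/-- The components of a context, without the constraints on their ranks. A context is determined
by them, and contexts of different arities can be compared through them. -/
def raw (C : Context T k n) : ℕ × ℕ × (Σ r, T.El r) × List (Σ r, T.El r) :=
  (C.k₁, C.k₂, ⟨_, C.u⟩, C.v.list)

theorem raw_injective : Function.Injective (raw : Context T k n → _) := by
  rintro ⟨k₁, ℓ, k₂, hk, u, v⟩ ⟨k₁', ℓ', k₂', hk', u', v'⟩ h
  simp only [raw, Prod.mk.injEq] at h
  obtain ⟨rfl, rfl, hu, hv⟩ := h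
  obtain rfl : ℓ = ℓ' := by omega
  obtain rfl := eq_of_heq (Sigma.mk.inj hu).2
  obtain rfl := Tup.ext hv
  rfl

/-- A congruence principle for the values of first components of elements of a block product at
contexts, for arities that are only propositionally equal. -/
theorem sigma_apply_congr {x y : Σ n, BlockEl S T k n} (e : x = y) {C : Context T k x.1}
    {D : Context T k y.1} (h : C.raw = D.raw) :
    (⟨x.1, x.2.1 C⟩ : Σ r, S.El r) = ⟨y.1, y.2.1 D⟩ := by
  subst e
  rw [raw_injective h]

theorem exists_sigma_apply_eq {x y : Σ n, BlockEl S T k n} (e : x = y) (C : Context T k x.1) :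
    ∃ D : Context T k y.1, D.raw = C.raw ∧
      (⟨x.1, x.2.1 C⟩ : Σ r, S.El r) = ⟨y.1, y.2.1 D⟩ := by
  subst e
  exact ⟨C, rfl, rfl⟩

theorem raw_absorb (C : Context T k m) (g : Tup T.El n m) :
    (C.absorb g).raw = (C.k₁, C.k₂, ⟨_, C.u⟩, T.lcomp g.list C.v.list) := by
  rw [← tupComp_list]
  rfl

theorem absorb_v_list (C : Context T k m) (g : Tup T.El n m) :
    (C.absorb g).v.list = T.lcomp g.list C.v.list :=
  tupComp_list g C.v

/-- The components of the context `Cᵢ`, in terms of the parts of `g = gl ⊕ x ⊕ gr` and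
`v = vl ⊕ vm ⊕ vr` before, at, and after the index `i`. -/
theorem raw_inner (C : Context T k m) (f : T.El n) (G : Tup (BlockEl S T k) n m) (i : Fin n)
    {gl gr vl vm vr : List (Σ r, T.El r)} {x : Σ r, T.El r}
    (hG : G.list.map (sigmaMap fun _ x => x.2) = gl ++ x :: gr) (hi : gl.length = i)
    (hv : C.v.list = vl ++ (vm ++ vr)) (hl : vl.length = totalRank gl) (hm : vm.length = x.1) :
    (C.inner f G i).raw = (C.k₁ + totalRank vl, totalRank vr + C.k₂,
      T.insert C.k₁ C.k₂ ⟨_, C.u⟩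
        (T.scomp ⟨n, f⟩ (T.lcomp gl vl ++ T.sone :: T.lcomp gr vr)), vm) := by
  have hr : vr.length = totalRank gr := by
    have h1 := C.v.length_eq
    have h2 := congrArg totalRank hG
    simp only [totalRank_map, G.totalRank_eq, totalRank_append, totalRank_cons] at h2
    simp only [hv, List.length_append] at h1
    omega
  have hw : (T.tupComp (G.map fun _ x => x.2) C.v).list =
      T.lcomp gl vl ++ T.scomp x vm :: T.lcomp gr vr := by
    rw [tupComp_list, Tup.map_list, hG, hv, lcomp_append hl, lcomp_cons_append hm]
  have hb : (T.tupComp (G.map fun _ x => x.2) C.v).before i = totalRank vl := by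
    rw [Tup.before, hw, ← hi]
    refine Eq.trans ?_ (totalRank_lcomp hl)
    simp [totalRank]
  have ha : (T.tupComp (G.map fun _ x => x.2) C.v).after i = totalRank vr := by
    rw [Tup.after, hw, ← hi]
    refine Eq.trans ?_ (totalRank_lcomp hr)
    rw [← List.singleton_append (l := T.lcomp gr vr), ← List.append_assoc,
      List.drop_left' (by simp)]
    rfl
  obtain ⟨hx, hbef⟩ := G.get_eq_of_map_list_eq _ i hG hi
  have hvm : (G.groupList C.v i) = vm := by
    rw [Tup.groupList_eq, (congrArg Sigma.fst hx : (G.get i).1 = x.1), hbef, hv, ← hl, ← hm]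
    simp
  have hu : (⟨_, (C.inner f G i).u⟩ : Σ r, T.El r) = T.insert C.k₁ C.k₂ ⟨_, C.u⟩
        (T.scomp ⟨n, f⟩ (T.lcomp gl vl ++ T.sone :: T.lcomp gr vr)) := by
    have hset : T.lcomp gl vl ++ T.sone :: T.lcomp gr vr =
        ((T.tupComp (G.map fun _ x => x.2) C.v).replace i T.one).list := by
      change _ = List.set _ _ _
      rw [hw, ← hi, List.set_append_right _ _ (by simp)]
      simp
    rw [hset, scomp_mk]
    refine (scomp_mk _ _).symm.trans ?_
    simp [insert, Tup.cast, Tup.append, Tup.single, ones]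
  simp only [raw, hu]
  simp only [inner, Tup.group, hvm, hb, ha]

end Context

/-! ### The block product is a preclone -/

/-- The projection of a block product to its second factor. -/
def blockSnd (S T : PrecloneData.{u}) (k : ℕ) : PrecloneHom (S.block T k) T where
  toFun _ x := x.2
  map_one := rfl
  map_comp _ _ := rfl

theorem block_comp_fst (F : BlockEl S T k n) (G : Tup (BlockEl S T k) n m) (C : Context T k m) :
    (⟨m, ((S.block T k).comp F G).1 C⟩ : Σ r, S.El r) =
      S.scomp ⟨n, F.1 (C.absorb (G.map fun _ x => x.2))⟩
        (List.ofFn fun i : Fin n => ⟨(G.get i).1, (G.get i).2.1 (C.inner F.2 G i)⟩) := by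
  refine Eq.trans ?_ (scomp_mk (S := S) (m := m) _
    ⟨List.ofFn fun i : Fin n => ⟨(G.get i).1, (G.get i).2.1 (C.inner F.2 G i)⟩, by simp, by
      rw [List.map_ofFn]; exact G.sum_get_fst⟩).symm
  rfl

theorem map_snd_tupComp (G : Tup (BlockEl S T k) n m) (H : Tup (BlockEl S T k) m p) :
    ((S.block T k).tupComp G H).list.map (sigmaMap fun _ x => x.2) =
      T.lcomp (G.list.map (sigmaMap fun _ x => x.2)) (H.list.map (sigmaMap fun _ x => x.2)) := by
  refine Eq.trans ?_ ((blockSnd S T k).map_lcomp G.list H.list)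
  exact congrArg (List.map (sigmaMap (blockSnd S T k).toFun))
    (tupComp_list (S := S.block T k) G H)

/-- The entry of `G` with index `i` and the corresponding group of `H`, read off from
decompositions of their second components. -/
theorem map_snd_groupList (G : Tup (BlockEl S T k) n m) (H : Tup (BlockEl S T k) m p) (i : Fin n)
    {gl gr hl hm hr : List (Σ r, T.El r)} {x : Σ r, T.El r}
    (hG : G.list.map (sigmaMap fun _ x => x.2) = gl ++ x :: gr) (hi : gl.length = i)
    (hH : H.list.map (sigmaMap fun _ x => x.2) = hl ++ (hm ++ hr)) (hL : hl.length = totalRank gl)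
    (hM : hm.length = x.1) :
    G.before i = totalRank gl ∧ (G.get i).1 = x.1 ∧ (⟨_, (G.get i).2.2⟩ : Σ r, T.El r) = x ∧
      (G.group H i).list.map (sigmaMap fun _ x => x.2) = hm := by
  obtain ⟨h1, h4⟩ := G.get_eq_of_map_list_eq _ i hG hi
  have h3 : (G.get i).1 = x.1 := congrArg Sigma.fst h1
  refine ⟨h4, h3, h1, ?_⟩
  change (G.groupList H i).map _ = _
  rw [Tup.groupList_eq, List.map_take, List.map_drop, h3, h4, hH, ← hL, ← hM]
  simp

namespace Context

/-- Absorbing `h` and then `g` is absorbing `g · h`. -/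
theorem absorb_absorb (hT : T.IsPreclone) (C : Context T k p) (G : Tup (BlockEl S T k) n m)
    (H : Tup (BlockEl S T k) m p) :
    (C.absorb (H.map fun _ x => x.2)).absorb (G.map fun _ x => x.2) =
      C.absorb (((S.block T k).tupComp G H).map fun _ x => x.2) := by
  apply raw_injective
  have h : ∀ E : Tup T.El n p, E.list = T.lcomp (G.list.map (sigmaMap fun _ x => x.2))
      (H.list.map (sigmaMap fun _ x => x.2)) →
      ((C.absorb (H.map fun _ x => x.2)).absorb (G.map fun _ x => x.2)).raw =
        (C.absorb E).raw := by
    intro E hE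
    rw [raw_absorb, raw_absorb, hE,
      hT.lcomp_lcomp (by rw [totalRank_map, List.length_map, H.length_eq, G.totalRank_eq])
        (by rw [totalRank_map, C.v.length_eq, H.totalRank_eq]), absorb_v_list]
    rfl
  exact h _ (map_snd_tupComp G H)

/-- The contexts at which the components of `g` are evaluated agree for both bracketings of
`f · g · h`. -/
theorem raw_inner_absorb (hT : T.IsPreclone) (C : Context T k p) (f : T.El n)
    (G : Tup (BlockEl S T k) n m) (H : Tup (BlockEl S T k) m p) (i : Fin n)
    (D : Context T k (G.groupRank H i))
    (hD : D.raw = (C.inner f ((S.block T k).tupComp G H) i).raw) :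
    ((C.absorb (H.map fun _ x => x.2)).inner f G i).raw =
      (D.absorb ((G.group H i).map fun _ x => x.2)).raw := by
  obtain ⟨gl, x, gr, hl, hm, hr, hG, hi, hH, hL, hM, hR⟩ :=
    exists_split (G.list.map (sigmaMap fun _ x => x.2)) (H.list.map (sigmaMap fun _ x => x.2))
      (by rw [totalRank_map, List.length_map, H.length_eq, G.totalRank_eq]) i
      (by rw [List.length_map, G.length_eq]; exact i.2)
  have hvl := C.v.length_eq
  have hHr := H.totalRank_eq
  rw [← totalRank_map (fun _ x => x.2) H.list, hH] at hHr
  simp only [totalRank_append] at hHr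
  obtain ⟨vl, vm, vr, hv, hvl, hvm, hvr⟩ : ∃ vl vm vr, C.v.list = vl ++ (vm ++ vr) ∧
      vl.length = totalRank hl ∧ vm.length = totalRank hm ∧ vr.length = totalRank hr :=
    C.v.list.exists_eq_append_append (hvl.trans hHr.symm)
  obtain ⟨-, -, -, hgrp⟩ := map_snd_groupList G H i hG hi hH hL hM
  have hGH := map_snd_tupComp G H
  rw [hG, hH, lcomp_append hL, lcomp_cons_append hM] at hGH
  rw [raw_inner C f _ i hGH (by simpa using hi) hv (by rw [totalRank_lcomp hL, hvl])
    (by rw [scomp_fst hM, hvm])] at hD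
  have hab : (C.absorb (H.map fun _ x => x.2)).v.list =
      T.lcomp hl vl ++ (T.lcomp hm vm ++ T.lcomp hr vr) := by
    rw [absorb_v_list, Tup.map_list, hH, hv, lcomp_append hvl, lcomp_append hvm]
  rw [raw_inner _ f G i hG hi hab (by simpa using hL) (by simpa using hM), raw_absorb,
    Tup.map_list, hgrp]
  simp only [raw, Prod.mk.injEq] at hD
  obtain ⟨h1, h2, h3, h4⟩ := hD
  rw [h3, h1, h2, h4, totalRank_lcomp hvl, totalRank_lcomp hvr, hT.lcomp_lcomp hL hvl,
    hT.lcomp_lcomp hR hvr]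
  rfl

/-- The contexts at which the components of `h` are evaluated agree for both bracketings of
`f · g · h`. The entry of `h` with index `j'` is the entry with index `j` of the group that belongs
to the entry of `g` with index `i`. -/
theorem raw_inner_inner (hT : T.IsPreclone) (C : Context T k p) (f : T.El n)
    (G : Tup (BlockEl S T k) n m) (H : Tup (BlockEl S T k) m p) (i : Fin n)
    (D : Context T k (G.groupRank H i))
    (hD : D.raw = (C.inner f ((S.block T k).tupComp G H) i).raw) (j : Fin (G.get i).1) (j' : Fin m)
    (hj : (j' : ℕ) = G.before i + j) :
    (C.inner (T.comp f (G.map fun _ x => x.2)) H j').raw =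
      (D.inner (G.get i).2.2 (G.group H i) j).raw := by
  obtain ⟨gl, x, gr, hl, hm, hr, hG, hi, hH, hL, hM, hR⟩ :=
    exists_split (G.list.map (sigmaMap fun _ x => x.2)) (H.list.map (sigmaMap fun _ x => x.2))
      (by rw [totalRank_map, List.length_map, H.length_eq, G.totalRank_eq]) i
      (by rw [List.length_map, G.length_eq]; exact i.2)
  have hvl := C.v.length_eq
  have hHr := H.totalRank_eq
  rw [← totalRank_map (fun _ x => x.2) H.list, hH] at hHr
  simp only [totalRank_append] at hHr
  obtain ⟨vl, vm, vr, hv, hvl, hvm, hvr⟩ : ∃ vl vm vr, C.v.list = vl ++ (vm ++ vr) ∧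
      vl.length = totalRank hl ∧ vm.length = totalRank hm ∧ vr.length = totalRank hr :=
    C.v.list.exists_eq_append_append (hvl.trans hHr.symm)
  obtain ⟨hbef, hrk, hx, hgrp⟩ := map_snd_groupList G H i hG hi hH hL hM
  obtain ⟨ha, y, hb, va, vy, vb, rfl, hja, rfl, hva, hvy, hvb⟩ :=
    exists_split hm vm hvm j (by rw [hM, ← hrk]; exact j.2)
  have hGH := map_snd_tupComp G H
  rw [hG, hH, lcomp_append hL, lcomp_cons_append hM] at hGH
  rw [raw_inner C f _ i hGH (by simpa using hi) hv (by rw [totalRank_lcomp hL, hvl])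
    (by rw [scomp_fst hM, hvm])] at hD
  simp only [raw, Prod.mk.injEq] at hD
  obtain ⟨h1, h2, h3, h4⟩ := hD
  have hn := G.length_eq
  rw [← List.length_map (sigmaMap fun _ x => x.2), hG] at hn
  have hgm : (G.map fun _ x => x.2).list = gl ++ x :: gr := hG
  simp only [List.length_append, List.length_cons] at hM hn
  -- The two nested insertions on the right-hand side collapse to a single insertion into `u`.
  have hins := hT.insert_insert (k₁ := C.k₁) (k₂ := C.k₂) (u := ⟨_, C.u⟩) (t := ⟨n, f⟩) rfl
    (vl := T.lcomp (T.lcomp gl hl) vl) (vr := T.lcomp (T.lcomp gr hr) vr) (by simp; omega)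
    (T.scomp x (T.lcomp ha va ++ T.sone :: T.lcomp hb vb))
  rw [totalRank_lcomp (by rw [totalRank_lcomp hL, hvl]),
    totalRank_lcomp (by rw [totalRank_lcomp hR, hvr])] at hins
  rw [raw_inner D _ _ j hgrp hja h4 hva hvy,
    raw_inner C _ H j' (gl := hl ++ ha) (x := y) (gr := hb ++ hr) (vl := vl ++ va) (vm := vy)
      (vr := vb ++ vr) (by rw [hH]; simp) (by simp; omega) (by rw [hv]; simp)
      (by simp; omega) hvy, h3, h1, h2, hx, hins]
  simp only [totalRank_append, Prod.mk.injEq]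
  refine ⟨by omega, by omega, ?_, trivial⟩
  have e : T.lcomp hl vl ++ T.lcomp ha va ++ T.sone :: (T.lcomp hb vb ++ T.lcomp hr vr) =
      T.lcomp hl vl ++ ((T.lcomp ha va ++ T.sone :: T.lcomp hb vb) ++ T.lcomp hr vr) := by
    simp
  congr 1
  rw [← scomp_mk, hgm, lcomp_append hvl, lcomp_append hvb, e,
    hT.scomp_scomp (by simpa using hn) (by simp; omega), lcomp_append (by simpa using hL),
    lcomp_cons_append (by simp; omega), hT.lcomp_lcomp hL hvl, hT.lcomp_lcomp hR hvr]

theorem absorb_ones (hT : T.IsPreclone) (C : Context T k n) : C.absorb (T.ones n) = C := by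
  apply raw_injective
  rw [raw_absorb]
  exact congrArg (fun L => (C.k₁, C.k₂, _, L)) (hT.replicate_lcomp _ C.v.length_eq.symm)

theorem inner_one (hT : T.IsPreclone) (C : Context T k n) (F : BlockEl S T k n) :
    C.inner T.one (Tup.single F) 0 = C := by
  apply raw_injective
  refine (raw_inner C T.one (Tup.single F) 0 (gl := []) (gr := []) (vl := []) (vm := C.v.list)
    (vr := []) (x := ⟨n, F.2⟩) rfl rfl (by simp) rfl C.v.length_eq).trans ?_
  have h : T.scomp T.sone [T.sone] = T.sone := hT.sone_scomp _
  have h' := hT.scomp_replicate ⟨_, C.u⟩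
  simp only [totalRank_nil, lcomp_nil, List.nil_append, h, insert, raw, Nat.add_zero, Nat.zero_add]
  rw [List.replicate_add, List.replicate_add, List.append_assoc] at h'
  exact congrArg (fun L => (C.k₁, C.k₂, L, C.v.list)) h'

end Context

/-- Associativity of the composition, in the first component of a block product. -/
theorem block_comp_comp_fst (hS : S.IsPreclone) (hT : T.IsPreclone) (F : BlockEl S T k n)
    (G : Tup (BlockEl S T k) n m) (H : Tup (BlockEl S T k) m p) (C : Context T k p) :
    (⟨p, ((S.block T k).comp ((S.block T k).comp F G) H).1 C⟩ : Σ r, S.El r) =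
      ⟨p, ((S.block T k).comp F ((S.block T k).tupComp G H)).1 C⟩ := by
  refine (block_comp_fst _ H C).trans (Eq.trans ?_
    (block_comp_fst F ((S.block T k).tupComp G H) C).symm)
  refine (congrArg (fun y => S.scomp y _) (block_comp_fst F G _)).trans ?_
  rw [hS.scomp_scomp (by simp)
    (by simpa [totalRank, Function.comp_def] using G.sum_get_fst.symm), C.absorb_absorb hT G H]
  congr 1
  apply List.ext_getElem
  · simp
  intro i h1 h2
  have hi : i < n := by simpa using h2
  have hGr : ((List.ofFn fun i : Fin n => (⟨(G.get i).1, (G.get i).2.1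
      ((C.absorb (H.map fun _ x => x.2)).inner F.2 G i)⟩ : Σ r, S.El r)).map Sigma.fst) =
      G.list.map Sigma.fst := by
    apply List.ext_getElem
    · simp [G.length_eq]
    · intro i _ _
      simp [Tup.get]
  have hrk : totalRank ((List.ofFn fun i : Fin n => (⟨(G.get i).1, (G.get i).2.1
      ((C.absorb (H.map fun _ x => x.2)).inner F.2 G i)⟩ : Σ r, S.El r)).take i) =
      G.before ⟨i, hi⟩ := by
    rw [totalRank, List.map_take, hGr, Tup.before, List.map_take]
  rw [getElem_lcomp _ _ _ (by simpa using hi), hrk]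
  simp only [List.getElem_ofFn]
  have e : ((S.block T k).tupComp G H).get ⟨i, hi⟩ = ⟨G.groupRank H ⟨i, hi⟩,
      (S.block T k).comp (G.get ⟨i, hi⟩).2 (G.group H ⟨i, hi⟩)⟩ :=
    List.getElem_ofFn _
  obtain ⟨D, hD, h⟩ := Context.exists_sigma_apply_eq e
    (C.inner F.2 ((S.block T k).tupComp G H) ⟨i, hi⟩)
  refine Eq.trans ?_ h.symm
  refine Eq.trans ?_ (block_comp_fst _ (G.group H ⟨i, hi⟩) D).symm
  congr 1
  · exact Context.sigma_apply_congr rfl (C.raw_inner_absorb hT F.2 G H ⟨i, hi⟩ D hD)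
  · have hle : G.before ⟨i, hi⟩ + (G.get ⟨i, hi⟩).1 ≤ m := by
      have := G.before_add_after ⟨i, hi⟩
      omega
    apply List.ext_getElem
    · simp; omega
    · intro j h3 h4
      have hj : j < (G.get ⟨i, hi⟩).1 := by simpa using h4
      simp only [List.getElem_take, List.getElem_drop, List.getElem_ofFn]
      refine Context.sigma_apply_congr ?_ (C.raw_inner_inner hT F.2 G H ⟨i, hi⟩ D hD ⟨j, hj⟩
        ⟨G.before ⟨i, hi⟩ + j, by omega⟩ rfl)
      simp [Tup.get, Tup.group, Tup.groupList_eq]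

theorem IsPreclone.block (hS : S.IsPreclone) (hT : T.IsPreclone) (k : ℕ) :
    (S.block T k).IsPreclone where
  one_comp {n} F := by
    refine Prod.ext (funext fun C => ?_) (hT.one_comp F.2)
    refine Eq.trans ?_ (hS.one_comp (F.1 C))
    change S.comp _ _ = _
    congr 1
    ext1
    simp only [List.ofFn_succ, List.ofFn_zero]
    exact congrArg (fun D => [(⟨n, F.1 D⟩ : Σ r, S.El r)]) (C.inner_one hT F)
  comp_ones {n} F := by
    refine Prod.ext (funext fun C => ?_) ?_
    · refine Eq.trans ?_ (hS.comp_ones (F.1 C))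
      change S.comp (F.1 _) _ = _
      have h := (blockSnd S T k).map_ones n
      congr 1
      · exact congrArg F.1 ((congrArg C.absorb h).trans (C.absorb_ones hT))
      · ext1
        apply List.ext_getElem
        · simp [ones]
        · intro i h1 h2
          have e : ∀ x : Σ r, (S.block T k).El r, x = ⟨1, (S.block T k).one⟩ →
              ∀ C : Context T k x.1, (⟨x.1, x.2.1 C⟩ : Σ r, S.El r) = S.sone := by
            rintro _ rfl C
            rfl
          simp only [List.getElem_ofFn]
          exact (e _ (List.getElem_replicate _) _).trans (by simp [ones])
    · exact (congrArg (T.comp F.2) ((blockSnd S T k).map_ones n)).trans (hT.comp_ones F.2)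
  assoc {n m p} F G H := by
    refine Prod.ext (funext fun C => ?_) ?_
    · exact eq_of_heq (Sigma.mk.inj (block_comp_comp_fst hS hT F G H C)).2
    · exact (hT.assoc F.2 _ _).trans (congrArg (T.comp F.2) ((blockSnd S T k).map_tupComp G H).symm)

end PrecloneData

namespace PrecloneHom

variable {S T : PrecloneData.{u}} (φ : PrecloneHom S T)

theorem sigmaMap_sone : sigmaMap φ.toFun S.sone = T.sone := by
  rw [sigmaMap, φ.map_one]

theorem sigmaMap_insert (k₁ k₂ : ℕ) (u z : Σ r, S.El r) :
    sigmaMap φ.toFun (S.insert k₁ k₂ u z) =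
      T.insert k₁ k₂ (sigmaMap φ.toFun u) (sigmaMap φ.toFun z) := by
  rw [PrecloneData.insert, φ.sigmaMap_scomp, List.map_append, List.map_cons, List.map_replicate,
    List.map_replicate, φ.sigmaMap_sone]
  rfl

end PrecloneHom

/-! ### Plugging contexts into contexts -/

namespace PrecloneData

variable {S S' T T' : PrecloneData.{u}} {k n m p : ℕ}

namespace Context

/-- The context `C ∘ D` obtained by plugging the context `D = (t, m₁, w, m₂)` over `T`, transported
along `φ : T → T'`, into the context `C = (u, k₁, v, k₂)` over `T'`. If `v = v' ⊕ v'' ⊕ v'''`,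
where `v'` has `m₁` and `v'''` has `m₂` entries, then its components are
`u · (𝐤₁ ⊕ t · (v' ⊕ 𝟏 ⊕ v''') ⊕ 𝐤₂)` and `w · v''`. -/
def plug (φ : PrecloneHom T T') (C : Context T' k m) (D : Context T m n) : Context T' k n where
  k₁ := C.k₁ + totalRank (C.v.list.take D.k₁)
  ℓ := totalRank ((C.v.list.drop D.k₁).take D.ℓ)
  k₂ := totalRank ((C.v.list.drop D.k₁).drop D.ℓ) + C.k₂
  rank_eq := by
    have h := C.v.totalRank_eq
    rw [← List.take_append_drop D.k₁ C.v.list, ← List.take_append_drop D.ℓ (List.drop _ _)] at h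
    simp only [totalRank_append] at h
    have := C.rank_eq
    omega
  u := T'.comp C.u
    ((((T'.ones C.k₁).append (Tup.single (T'.comp (φ.toFun _ D.u)
      ⟨C.v.list.take D.k₁ ++ T'.sone :: (C.v.list.drop D.k₁).drop D.ℓ, by
        have := D.rank_eq
        simp [C.v.length_eq]; omega, rfl⟩))).append (T'.ones C.k₂)).cast (by
          change _ + totalRank _ + _ = _
          simp; omega))
  v := T'.tupComp (D.v.map φ.toFun) ⟨(C.v.list.drop D.k₁).take D.ℓ, by
    have := D.rank_eq
    simp [C.v.length_eq]; omega, rfl⟩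

theorem raw_plug (φ : PrecloneHom T T') (C : Context T' k m) (D : Context T m n)
    {vl vm vr : List (Σ r, T'.El r)} (hv : C.v.list = vl ++ (vm ++ vr)) (hl : vl.length = D.k₁)
    (hm : vm.length = D.ℓ) :
    (C.plug φ D).raw = (C.k₁ + totalRank vl, totalRank vr + C.k₂,
      T'.insert C.k₁ C.k₂ ⟨_, C.u⟩
        (T'.scomp (sigmaMap φ.toFun ⟨_, D.u⟩) (vl ++ T'.sone :: vr)),
      T'.lcomp (D.v.list.map (sigmaMap φ.toFun)) vm) := by
  have h1 : C.v.list.take D.k₁ = vl := by rw [hv, ← hl]; simp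
  have h2 : (C.v.list.drop D.k₁).take D.ℓ = vm := by rw [hv, ← hl, ← hm]; simp
  have h3 : (C.v.list.drop D.k₁).drop D.ℓ = vr := by rw [hv, ← hl, ← hm]; simp
  have hu : (⟨_, (C.plug φ D).u⟩ : Σ r, T'.El r) = T'.insert C.k₁ C.k₂ ⟨_, C.u⟩
        (T'.scomp (sigmaMap φ.toFun ⟨_, D.u⟩) (vl ++ T'.sone :: vr)) := by
    refine (scomp_mk _ _).symm.trans ?_
    have h4 := scomp_mk (φ.toFun _ D.u)
      ⟨C.v.list.take D.k₁ ++ T'.sone :: (C.v.list.drop D.k₁).drop D.ℓ, by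
        have := D.rank_eq
        simp [C.v.length_eq]; omega, rfl⟩
    rw [← h1, ← h3, h4]
    simp [insert, Tup.cast, Tup.append, Tup.single, ones]
  have hv' : (C.plug φ D).v.list = T'.lcomp (D.v.list.map (sigmaMap φ.toFun)) vm := by
    rw [← h2]
    exact tupComp_list _ _
  simp only [raw, hu, hv']
  simp only [plug, h1, h3]

theorem exists_plug_split (C : Context T' k m) (D : Context T m n) :
    ∃ vl vm vr, C.v.list = vl ++ (vm ++ vr) ∧ vl.length = D.k₁ ∧ vm.length = D.ℓ ∧
      vr.length = D.k₂ := by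
  have := D.rank_eq
  exact C.v.list.exists_eq_append_append (C.v.length_eq.trans (by omega))

/-- Plugging into a fixed context commutes with absorption. -/
theorem plug_absorb (hT : T'.IsPreclone) (φ : PrecloneHom T T') (C : Context T' k m)
    (D : Context T m p) (g : Tup T.El n p) :
    C.plug φ (D.absorb g) = (C.plug φ D).absorb (g.map φ.toFun) := by
  apply raw_injective
  obtain ⟨vl, vm, vr, hv, hl, hm, hr⟩ := exists_plug_split C D
  have h := raw_plug φ C D hv hl hm
  simp only [raw, Prod.mk.injEq] at h
  obtain ⟨h1, h2, h3, h4⟩ := h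
  rw [raw_plug φ C (D.absorb g) hv hl hm, raw_absorb, h3, h1, h2, h4, Tup.map_list,
    absorb_v_list, φ.map_lcomp, hT.lcomp_lcomp]
  · rfl
  · rw [totalRank_map, List.length_map, D.v.length_eq, g.totalRank_eq]
  · rw [totalRank_map, D.v.totalRank_eq, hm]

/-- Plugging into a fixed context takes the inner contexts of `D` to the inner contexts of
`C ∘ D`. -/
theorem raw_plug_inner (hT : T'.IsPreclone) (φ : PrecloneHom T T') (C : Context T' k m)
    (D : Context T m p) (f : T.El n) (G : Tup (BlockEl S T m) n p) (G' : Tup (BlockEl S' T' k) n p)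
    (hG' : (G.map fun _ x => x.2).map φ.toFun = G'.map fun _ x => x.2) (i : Fin n) :
    (C.plug φ (D.inner f G i)).raw = ((C.plug φ D).inner (φ.toFun n f) G' i).raw := by
  obtain ⟨vl, vm, vr, hv, hl, hm, hr⟩ := exists_plug_split C D
  obtain ⟨gl, x, gr, wl, wm, wr, hG, hi, hw, hwl, hwm, hwr⟩ :=
    exists_split (G.list.map (sigmaMap fun _ x => x.2)) D.v.list
      (by rw [totalRank_map, D.v.length_eq, G.totalRank_eq]) i
      (by rw [List.length_map, G.length_eq]; exact i.2)
  have hDr := D.v.totalRank_eq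
  rw [hw] at hDr
  simp only [totalRank_append] at hDr
  obtain ⟨va, vb, vc, rfl, ha, hb, hc⟩ : ∃ va vb vc, vm = va ++ (vb ++ vc) ∧
      va.length = totalRank wl ∧ vb.length = totalRank wm ∧ vc.length = totalRank wr :=
    vm.exists_eq_append_append (hm.trans hDr.symm)
  have hl' : (wl.map (sigmaMap φ.toFun)).length = totalRank (gl.map (sigmaMap φ.toFun)) := by
    rwa [List.length_map, totalRank_map]
  have hr' : (wr.map (sigmaMap φ.toFun)).length = totalRank (gr.map (sigmaMap φ.toFun)) := by
    rwa [List.length_map, totalRank_map]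
  have hva : va.length = totalRank (wl.map (sigmaMap φ.toFun)) := by rwa [totalRank_map]
  have hvb : vb.length = totalRank (wm.map (sigmaMap φ.toFun)) := by rwa [totalRank_map]
  have hvc : vc.length = totalRank (wr.map (sigmaMap φ.toFun)) := by rwa [totalRank_map]
  have hGm : G'.list.map (sigmaMap fun _ x => x.2) =
      gl.map (sigmaMap φ.toFun) ++ sigmaMap φ.toFun x :: gr.map (sigmaMap φ.toFun) := by
    have := congrArg Tup.list hG'
    rw [Tup.map_list, Tup.map_list, Tup.map_list, hG] at this
    rw [← this]; simp
  have hn := G.length_eq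
  rw [← List.length_map (sigmaMap fun _ x => x.2), hG] at hn
  simp only [List.length_append, List.length_cons] at hn
  have hP := raw_plug φ C D hv hl hm
  have hI := raw_inner D f G i hG hi hw hwl hwm
  simp only [raw, Prod.mk.injEq] at hP hI
  obtain ⟨p1, p2, p3, p4⟩ := hP
  obtain ⟨i1, i2, i3, i4⟩ := hI
  rw [hw, List.map_append, List.map_append, lcomp_append hva, lcomp_append hvb] at p4
  have hins := hT.insert_insert (k₁ := C.k₁) (k₂ := C.k₂) (u := ⟨_, C.u⟩)
    (t := sigmaMap φ.toFun ⟨_, D.u⟩) rfl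
    (vl := vl) (vr := vr) (by simp; omega)
    (T'.scomp ⟨n, φ.toFun n f⟩ (T'.lcomp (gl.map (sigmaMap φ.toFun))
      (T'.lcomp (wl.map (sigmaMap φ.toFun)) va) ++ T'.sone ::
        T'.lcomp (gr.map (sigmaMap φ.toFun)) (T'.lcomp (wr.map (sigmaMap φ.toFun)) vc)))
  rw [raw_inner _ _ _ _ hGm (by simpa using hi) p4 (by simpa using hl') (by simpa using hwm),
    p3, p1, p2, hins, raw_plug φ C (D.inner f G i) (vl := vl ++ va) (vm := vb) (vr := vc ++ vr)
      (by rw [hv]; simp) (by simp; omega)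
      (by rw [hb, ← i4]; exact (D.inner f G i).v.totalRank_eq), i3, i4]
  simp only [totalRank_append, totalRank_lcomp hva, totalRank_lcomp hvc, Prod.mk.injEq]
  refine ⟨by omega, by omega, ?_, trivial⟩
  congr 1
  have e : vl ++ va ++ T'.sone :: (vc ++ vr) = vl ++ ((va ++ T'.sone :: vc) ++ vr) := by simp
  have hrk : (T.scomp ⟨n, f⟩ (T.lcomp gl wl ++ T.sone :: T.lcomp gr wr)).1 =
      (va ++ T'.sone :: vc).length := by
    refine (scomp_fst (by simpa using hn)).trans ?_
    simp [totalRank_lcomp hwl, totalRank_lcomp hwr, ha, hc]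
    omega
  rw [φ.sigmaMap_insert, insert, hT.scomp_scomp (by simp; omega)
    (by simp only [List.length_append, List.length_cons, totalRank_append, totalRank_cons,
      totalRank_replicate, hrk]; omega), e, lcomp_append (by simpa using hl),
    lcomp_cons_append hrk.symm, hT.replicate_lcomp _ hl.symm, hT.replicate_lcomp _ hr.symm,
    φ.sigmaMap_scomp, List.map_append, List.map_cons, φ.sigmaMap_sone, φ.map_lcomp, φ.map_lcomp,
    hT.scomp_scomp (by simpa using hn) (by
      simp [totalRank_lcomp hl', totalRank_lcomp hr', ha, hc]; omega),
    lcomp_append (by rw [totalRank_lcomp hl', hva]),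
    ← List.singleton_append (l := vc), lcomp_cons_append rfl, hT.sone_scomp,
    hT.lcomp_lcomp hl' hva, hT.lcomp_lcomp hr' hvc]

/-- The context `(𝟏, 0, 𝐧, 0)`, the identity for plugging. -/
def identity (T : PrecloneData.{u}) (n : ℕ) : Context T n n where
  k₁ := 0
  ℓ := n
  k₂ := 0
  rank_eq := by simp
  u := T.one
  v := T.ones n

theorem plug_identity (hT : T'.IsPreclone) (φ : PrecloneHom T T') (C : Context T' k n) :
    C.plug φ (identity T n) = C := by
  apply raw_injective
  refine (raw_plug φ C (identity T n) (vl := []) (vm := C.v.list)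
    (vr := []) (by simp) rfl C.v.length_eq).trans ?_
  have h : T'.scomp (sigmaMap φ.toFun ⟨_, (identity T n).u⟩) [T'.sone] = T'.sone := by
    exact (congrArg (fun x => T'.scomp x [T'.sone]) φ.sigmaMap_sone).trans (hT.sone_scomp _)
  have h' := hT.scomp_replicate ⟨_, C.u⟩
  have hv : T'.lcomp ((identity T n).v.list.map (sigmaMap φ.toFun)) C.v.list = C.v.list := by
    refine Eq.trans ?_ (hT.replicate_lcomp _ C.v.length_eq.symm)
    exact congrArg (fun g => T'.lcomp g C.v.list) (congrArg Tup.list (φ.map_ones n))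
  simp only [totalRank_nil, hv, List.nil_append, h, insert, raw, Nat.add_zero, Nat.zero_add]
  rw [List.replicate_add, List.replicate_add, List.append_assoc] at h'
  exact congrArg (fun L => (C.k₁, C.k₂, L, C.v.list)) h'

end Context
end PrecloneData

/-! ### Morphisms and sub-preclones -/

theorem Tup.exists_map_eq {El El' : ℕ → Type u} {n m : ℕ} (φ : ∀ r, El r → El' r)
    (g : Tup El' n m) (h : ∀ x ∈ g.list, x.2 ∈ Set.range (φ x.1)) :
    ∃ g' : Tup El n m, g'.map φ = g := by
  have hg : g.list ∈ Set.range (List.map (sigmaMap φ)) := by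
    rw [Set.range_list_map]
    rintro ⟨r, x⟩ hx
    obtain ⟨y, hy⟩ := h _ hx
    exact ⟨⟨r, y⟩, by rw [sigmaMap, hy]⟩
  obtain ⟨L, hL⟩ := hg
  refine ⟨⟨L, ?_, ?_⟩, Tup.ext hL⟩
  · rw [← g.length_eq, ← hL, List.length_map]
  · rw [← g.totalRank_eq, ← hL, totalRank_map]
    rfl

namespace SubPreclone

variable {S T : PrecloneData.{u}}

/-- The inclusion of a sub-preclone. -/
def subtype (B : SubPreclone S) : PrecloneHom B.toPreclone S where
  toFun _ x := x.1
  map_one := rfl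
  map_comp _ _ := rfl

theorem isPreclone (hS : S.IsPreclone) (B : SubPreclone S) : B.toPreclone.IsPreclone :=
  B.subtype.isPreclone_of_injective (fun _ => Subtype.val_injective) hS

/-- The inverse image of a sub-preclone. -/
def comap (φ : PrecloneHom S T) (B : SubPreclone T) : SubPreclone S where
  carrier n := φ.toFun n ⁻¹' B.carrier n
  one_mem := by
    rw [Set.mem_preimage, φ.map_one]
    exact B.one_mem
  comp_mem f g hf hg := by
    rw [Set.mem_preimage, φ.map_comp]
    refine B.comp_mem _ _ hf fun x hx => ?_
    obtain ⟨y, hy, rfl⟩ := List.mem_map.1 hx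
    exact hg y hy

theorem subset_generated (S : PrecloneData.{u}) (A : ∀ n, Set (S.El n)) (n : ℕ) :
    A n ⊆ (generated S A).carrier n :=
  fun _ hx _ hB => hB n hx

end SubPreclone

namespace PrecloneHom

variable {S T U : PrecloneData.{u}}

/-- The identity morphism. -/
def id (S : PrecloneData.{u}) : PrecloneHom S S where
  toFun _ x := x
  map_one := rfl
  map_comp f g := by rw [Tup.map_id]

/-- Composition of morphisms. -/
def comp (ψ : PrecloneHom T U) (φ : PrecloneHom S T) : PrecloneHom S U where
  toFun n x := ψ.toFun n (φ.toFun n x)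
  map_one := by rw [φ.map_one, ψ.map_one]
  map_comp f g := by rw [φ.map_comp, ψ.map_comp, Tup.map_map]

/-- A morphism with values in a sub-preclone, as a morphism to that sub-preclone. -/
def codRestrict (φ : PrecloneHom S T) (B : SubPreclone T)
    (h : ∀ n x, φ.toFun n x ∈ B.carrier n) : PrecloneHom S B.toPreclone where
  toFun n x := ⟨φ.toFun n x, h n x⟩
  map_one := Subtype.ext φ.map_one
  map_comp f g := Subtype.ext ((φ.map_comp f g).trans (by
    rw [← Tup.map_map (fun r x => (⟨φ.toFun r x, h r x⟩ : B.toPreclone.El r))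
      (fun _ x => x.1) g]
    rfl))

/-- The image of a morphism. -/
def range (φ : PrecloneHom S T) : SubPreclone T where
  carrier n := Set.range (φ.toFun n)
  one_mem := ⟨S.one, φ.map_one⟩
  comp_mem := by
    rintro n m _ g ⟨f, rfl⟩ hg
    obtain ⟨g, rfl⟩ := g.exists_map_eq φ.toFun hg
    exact ⟨_, φ.map_comp f g⟩

/-- A morphism, as a surjective morphism to its image. -/
def rangeRestrict (φ : PrecloneHom S T) : PrecloneHom S φ.range.toPreclone :=
  φ.codRestrict φ.range fun _ x => ⟨x, rfl⟩

theorem rangeRestrict_surjective (φ : PrecloneHom S T) (n : ℕ) :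
    Function.Surjective (φ.rangeRestrict.toFun n) := by
  rintro ⟨_, x, rfl⟩
  exact ⟨x, rfl⟩

/-- The morphism to a direct product given by its components. -/
def toPi {ι : Type} {P : ι → PrecloneData.{u}} (φ : ∀ i, PrecloneHom S (P i)) :
    PrecloneHom S (PrecloneData.pi P) where
  toFun n x i := (φ i).toFun n x
  map_one := funext fun i => (φ i).map_one
  map_comp f g := funext fun i => ((φ i).map_comp f g).trans (by
    rw [← Tup.map_map (fun r x i => (φ i).toFun r x) (fun _ x => x i) g]
    rfl)

section lift

variable (φ : PrecloneHom S T) (hφ : ∀ n, Function.Surjective (φ.toFun n)) (ψ : PrecloneHom S U)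
  (h : ∀ n x y, φ.toFun n x = φ.toFun n y → ψ.toFun n x = ψ.toFun n y)

/-- The factorization of a morphism `ψ` through a surjective morphism `φ` with smaller kernel. -/
noncomputable def lift : PrecloneHom T U where
  toFun n y := ψ.toFun n (hφ n y).choose
  map_one := by
    rw [← ψ.map_one]
    exact h _ _ _ ((hφ 1 T.one).choose_spec.trans φ.map_one.symm)
  map_comp {n m} f g := by
    obtain ⟨g, rfl⟩ := g.exists_map_eq φ.toFun fun x _ => hφ _ x.2
    have hf := (hφ n f).choose_spec
    have hg : (g.map φ.toFun).map (fun r y => ψ.toFun r (hφ r y).choose) = g.map ψ.toFun :=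
      (Tup.map_map _ _ g).trans (Tup.map_congr fun x _ => h _ _ x.2 (hφ _ _).choose_spec)
    refine Eq.trans ?_ ((ψ.map_comp _ _).trans (congrArg (U.comp _) hg.symm))
    exact h _ _ _ ((hφ m _).choose_spec.trans (by rw [φ.map_comp, hf]))

theorem lift_apply (n : ℕ) (x : S.El n) : (lift φ hφ ψ h).toFun n (φ.toFun n x) = ψ.toFun n x :=
  h _ _ _ (hφ n _).choose_spec

end lift

/-! ### A finitary preclone as the limit of its images -/

section tower

variable {Z : ℕ → PrecloneData.{u}} (η : ∀ j, PrecloneHom S (Z j))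
  (hη : ∀ j n x y, (η (j + 1)).toFun n x = (η (j + 1)).toFun n y →
    (η j).toFun n x = (η j).toFun n y)

/-- For morphisms `ηⱼ` with decreasing kernels, the morphisms `im ηⱼ₊₁ → im ηⱼ` under `S`. -/
noncomputable def towerMap (j : ℕ) :
    PrecloneHom (η (j + 1)).range.toPreclone (η j).range.toPreclone :=
  lift (η (j + 1)).rangeRestrict (η (j + 1)).rangeRestrict_surjective (η j).rangeRestrict
    fun n x y e => Subtype.ext (hη j n x y (congrArg Subtype.val e))

/-- The morphism from `S` to the inverse limit of its images `im ηⱼ`. -/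
noncomputable def toTowerLimit :
    PrecloneHom S (PrecloneData.limit (fun j => (η j).range.toPreclone)
      (towerMap η hη)).toPreclone :=
  (toPi fun j => (η j).rangeRestrict).codRestrict _ fun n x j =>
    lift_apply _ (η (j + 1)).rangeRestrict_surjective _ _ n x

theorem toTowerLimit_injective {n j : ℕ} (hj : Function.Injective ((η j).toFun n)) :
    Function.Injective ((toTowerLimit η hη).toFun n) := fun _ _ e =>
  hj (congrArg Subtype.val (congrFun (congrArg Subtype.val e) j))

/-- A compatible family of elements of the images of `S` is determined by any component at which
the morphism from `S` is injective, and so it comes from `S`. -/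
theorem toTowerLimit_surjective {n J : ℕ} (hJ : Function.Injective ((η J).toFun n)) :
    Function.Surjective ((toTowerLimit η hη).toFun n) := by
  intro y
  obtain ⟨a, ha⟩ := (η J).rangeRestrict_surjective n (y.1 J)
  have hinj : ∀ i, Function.Injective ((η (J + i)).toFun n) := by
    intro i
    induction i with
    | zero => exact hJ
    | succ i ih => exact fun x z e => ih (hη _ _ _ _ e)
  have hmap : ∀ j x, (towerMap η hη j).toFun n ((η (j + 1)).rangeRestrict.toFun n x) =
      (η j).rangeRestrict.toFun n x := fun j x =>
    lift_apply _ (η (j + 1)).rangeRestrict_surjective _ _ n x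
  have hup : ∀ i, (η (J + i)).rangeRestrict.toFun n a = y.1 (J + i) := by
    intro i
    induction i with
    | zero => exact ha
    | succ i ih =>
      obtain ⟨b, hb⟩ := (η (J + i + 1)).rangeRestrict_surjective n (y.1 (J + i + 1))
      have h1 : (towerMap η hη (J + i)).toFun n (y.1 (J + i + 1)) = y.1 (J + i) := y.2 (J + i)
      rw [← hb, hmap, ← ih] at h1
      rw [← hinj i (congrArg Subtype.val h1)]
      exact hb
  have hdown : ∀ i j, (η (j + i)).rangeRestrict.toFun n a = y.1 (j + i) →
      (η j).rangeRestrict.toFun n a = y.1 j := by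
    intro i
    induction i with
    | zero => exact fun j h => h
    | succ i ih =>
      intro j h
      refine ih j ?_
      have h1 : (towerMap η hη (j + i)).toFun n (y.1 (j + i + 1)) = y.1 (j + i) := y.2 (j + i)
      rw [← h1, ← hmap]
      exact congrArg _ h
  refine ⟨a, Subtype.ext (funext fun j => hdown J j ?_)⟩
  rw [Nat.add_comm]
  exact hup j

end tower

/-- At each rank, which is finite, finitely many of the morphisms suffice for separation. -/
theorem exists_separating_index (hS : S.IsFinitary) {Y : ℕ → PrecloneData.{u}}
    (ψ : ∀ i, PrecloneHom S (Y i))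
    (hsep : ∀ n x y, (∀ i, (ψ i).toFun n x = (ψ i).toFun n y) → x = y) (n : ℕ) :
    ∃ J, ∀ x y, (∀ i ≤ J, (ψ i).toFun n x = (ψ i).toFun n y) → x = y := by
  have h : ∀ p : S.El n × S.El n, ∃ i,
      (ψ i).toFun n p.1 = (ψ i).toFun n p.2 → p.1 = p.2 := by
    rintro ⟨x, y⟩
    by_contra! h
    exact (h 0).2 (hsep n x y fun i => (h i).1)
  choose N hN using h
  have := hS n
  obtain ⟨J, hJ⟩ := Finite.exists_le N
  exact ⟨J, fun x y e => hN (x, y) (e _ (hJ _))⟩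

end PrecloneHom

open PrecloneHom

/-- A finitary preclone is in a pseudovariety if countably many morphisms to members of the
pseudovariety separate its elements: it is the inverse limit of its images in the products of
finitely many of these members. -/
theorem IsPseudovariety.mem_of_separating {V : Set PrecloneData.{u}} (hV : IsPseudovariety V)
    {X : PrecloneData.{u}} (hX : X.IsPreclone) (hfin : X.IsFinitary) {Y : ℕ → PrecloneData.{u}}
    (hY : ∀ i, Y i ∈ V) (ψ : ∀ i, PrecloneHom X (Y i))
    (hsep : ∀ n x y, (∀ i, (ψ i).toFun n x = (ψ i).toFun n y) → x = y) : X ∈ V := by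
  let η : ∀ j, PrecloneHom X (PrecloneData.pi fun i : Fin (j + 1) => Y i) :=
    fun j => toPi fun i => ψ i
  have hη : ∀ j n x y, (η (j + 1)).toFun n x = (η (j + 1)).toFun n y →
      (η j).toFun n x = (η j).toFun n y := fun j n x y e =>
    funext fun i => congrFun e i.castSucc
  have hinj : ∀ n, ∃ J, Function.Injective ((η J).toFun n) := by
    intro n
    obtain ⟨J, hJ⟩ := exists_separating_index hfin ψ hsep n
    exact ⟨J, fun x y e => hJ x y fun i hi => congrFun e ⟨i, by omega⟩⟩
  have hsurj : ∀ n, Function.Surjective ((toTowerLimit η hη).toFun n) := fun n =>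
    (hinj n).elim fun _ h => toTowerLimit_surjective η hη h
  have hinj' : ∀ n, Function.Injective ((toTowerLimit η hη).toFun n) := fun n =>
    (hinj n).elim fun _ h => toTowerLimit_injective η hη h
  have hlim := hV.limit_mem (fun j => (η j).range.toPreclone) (towerMap η hη)
    (fun j => hV.sub_mem _ (hV.pi_mem (Fin (j + 1)) _ fun i => hY i) _)
    (fun n => have := hfin n; Finite.of_surjective _ (hsurj n))
  exact hV.quotient_mem _ hlim X hX (lift _ hsurj (PrecloneHom.id X) fun n x y e => hinj' n e)
    fun n x => ⟨(toTowerLimit η hη).toFun n x, lift_apply _ hsurj _ _ n x⟩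

namespace PGData

/-- The whole image of a `pg`-pair lies in the sub-preclone generated by the images of its
generators. -/
theorem IsPGPair.map_mem_generated {X : PGData.{u}} (hX : X.IsPGPair) {T : PrecloneData.{u}}
    (φ : PrecloneHom X.S T) {B : ∀ n, Set (T.El n)} (h : ∀ n, ∀ x ∈ X.A n, φ.toFun n x ∈ B n)
    (n : ℕ) (x : X.S.El n) : φ.toFun n x ∈ (SubPreclone.generated T B).carrier n :=
  hX.2 n x (SubPreclone.comap φ (SubPreclone.generated T B)) fun r y hy => SubPreclone.subset_generated T B r (h r y hy)

theorem IsPGPair.of_surjective {X Q : PGData.{u}} (hX : X.IsPGPair) (hQ : Q.S.IsPreclone)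
    (φ : PrecloneHom X.S Q.S) (hφ : ∀ n, Function.Surjective (φ.toFun n))
    (h : ∀ n, ∀ x ∈ X.A n, φ.toFun n x ∈ Q.A n) : Q.IsPGPair := by
  refine ⟨hQ, fun n y => ?_⟩
  obtain ⟨x, rfl⟩ := hφ n y
  exact hX.map_mem_generated φ h n x

theorem isPGPair_generated {S : PrecloneData.{u}} (hS : S.IsPreclone) (A : ∀ n, Set (S.El n)) :
    (generated S A).IsPGPair := by
  refine ⟨SubPreclone.isPreclone hS _, fun n x B hB => ?_⟩
  obtain ⟨y, hy⟩ := x.2 ((SubPreclone.subtype _).comp B.subtype).range fun r a ha =>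
    ⟨⟨⟨a, SubPreclone.subset_generated S A r ha⟩, hB r ha⟩, rfl⟩
  have : y.1 = x := Subtype.ext hy
  exact this ▸ y.2

/-- The image of a morphism, together with the images of the generators. -/
def range {X : PGData.{u}} {T : PrecloneData.{u}} (φ : PrecloneHom X.S T) : PGData.{u} where
  S := φ.range.toPreclone
  A n := φ.rangeRestrict.toFun n '' X.A n

end PGData

/-- Images under morphisms to members of a pseudovariety are members: they are the sub-`pg`-pairs
on the images of the generators. -/
theorem IsPGPseudovariety.range_mem {V : Set PGData.{u}} (hV : IsPGPseudovariety V)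
    {X Y : PGData.{u}} (hX : X.IsPGPair) (hY : Y ∈ V) (φ : PrecloneHom X.S Y.S)
    (h : ∀ n, ∀ x ∈ X.A n, φ.toFun n x ∈ Y.A n) : PGData.range φ ∈ V := by
  have hpre : φ.range.toPreclone.IsPreclone := SubPreclone.isPreclone (hV.isPGPair Y hY).1 _
  have hW := hV.sub_mem Y hY (fun n => φ.toFun n '' X.A n) (by
    rintro n _ ⟨x, hx, rfl⟩
    exact h n x hx)
  refine hV.quotient_mem _ hW _ (hX.of_surjective hpre φ.rangeRestrict
    φ.rangeRestrict_surjective fun n x hx => ⟨x, hx, rfl⟩)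
    ((SubPreclone.subtype _).codRestrict φ.range fun n y => y.2 φ.range ?_) fun n => ?_
  · rintro r _ ⟨x, -, rfl⟩
    exact ⟨x, rfl⟩
  · ext y
    constructor
    · rintro ⟨⟨_, _⟩, ⟨x, hx, rfl⟩, rfl⟩
      exact ⟨x, hx, rfl⟩
    · rintro ⟨x, hx, rfl⟩
      exact ⟨⟨φ.toFun n x, SubPreclone.subset_generated _ _ n ⟨x, hx, rfl⟩⟩, ⟨x, hx, rfl⟩, rfl⟩

/-- The analogue of `IsPseudovariety.mem_of_separating` for `pg`-pairs. -/
theorem IsPGPseudovariety.mem_of_separating {V : Set PGData.{u}} (hV : IsPGPseudovariety V)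
    {X : PGData.{u}} (hX : X.IsPGPair) (hfin : X.IsFinitary) {Y : ℕ → PGData.{u}}
    (hY : ∀ i, Y i ∈ V) (ψ : ∀ i, PrecloneHom X.S (Y i).S)
    (hψ : ∀ i n, ∀ x ∈ X.A n, (ψ i).toFun n x ∈ (Y i).A n)
    (hsep : ∀ n x y, (∀ i, (ψ i).toFun n x = (ψ i).toFun n y) → x = y) : X ∈ V := by
  let η : ∀ j, PrecloneHom X.S (PGData.pi fun i : Fin (j + 1) => Y i).S :=
    fun j => (toPi fun i : Fin (j + 1) => ψ i).codRestrict _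
      (hX.map_mem_generated _ fun n x hx i => hψ i n x hx)
  have hη : ∀ j n x y, (η (j + 1)).toFun n x = (η (j + 1)).toFun n y →
      (η j).toFun n x = (η j).toFun n y := fun j n x y e =>
    Subtype.ext (funext fun i => congrFun (congrArg Subtype.val e) i.castSucc)
  have hinj : ∀ n, ∃ J, Function.Injective ((η J).toFun n) := by
    intro n
    obtain ⟨J, hJ⟩ := exists_separating_index hfin.1 ψ hsep n
    exact ⟨J, fun x y e => hJ x y fun i hi => congrFun (congrArg Subtype.val e) ⟨i, by omega⟩⟩
  have hsurj : ∀ n, Function.Surjective ((toTowerLimit η hη).toFun n) := fun n =>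
    (hinj n).elim fun _ h => toTowerLimit_surjective η hη h
  have hinj' : ∀ n, Function.Injective ((toTowerLimit η hη).toFun n) := fun n =>
    (hinj n).elim fun _ h => toTowerLimit_injective η hη h
  let R : ℕ → PGData.{u} := fun j => PGData.range (η j)
  have hR : ∀ j, R j ∈ V := fun j => hV.range_mem hX (hV.pi_mem (Fin (j + 1)) _ fun i => hY i) (η j)
    fun n x hx i => hψ i n x hx
  let θ : PrecloneHom (PGData.limit R (towerMap η hη)).S X.S :=
    (lift _ hsurj (PrecloneHom.id X.S) fun n x y e => hinj' n e).comp (SubPreclone.subtype _)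
  have hθ : ∀ n x a, (toTowerLimit η hη).toFun n a = x.1 → θ.toFun n x = a := fun n x a e =>
    (congrArg ((lift _ hsurj (PrecloneHom.id X.S) fun n x y e => hinj' n e).toFun n) e.symm).trans
      (lift_apply _ hsurj _ _ n a)
  have hθinj : ∀ n, Function.Injective (θ.toFun n) := by
    intro n x y e
    obtain ⟨a, ha⟩ := hsurj n x.1
    obtain ⟨b, hb⟩ := hsurj n y.1
    rw [hθ n x a ha, hθ n y b hb] at e
    exact Subtype.ext (by rw [← ha, ← hb, e])
  -- A compatible family of images of generators is the image of a single generator.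
  have hgen : ∀ n, ∀ x ∈ (PGData.limit R (towerMap η hη)).A n, ∃ a ∈ X.A n,
      (toTowerLimit η hη).toFun n a = x.1 := by
    intro n x hx
    obtain ⟨J, hJ⟩ := hinj n
    obtain ⟨a, ha⟩ := hsurj n x.1
    obtain ⟨b, hb, e⟩ := hx J
    rw [← ha] at e
    obtain rfl := hJ (congrArg Subtype.val e)
    exact ⟨b, hb, ha⟩
  have hlim : PGData.limit R (towerMap η hη) ∈ V := by
    refine hV.limit_mem R (towerMap η hη) ?_ hR ⟨fun n => ?_, ?_⟩
    · rintro j n _ ⟨_, ⟨x, hx, rfl⟩, rfl⟩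
      exact ⟨x, hx, (lift_apply _ (η (j + 1)).rangeRestrict_surjective _ _ n x).symm⟩
    · have := hfin.1 n
      exact Finite.of_injective _ (hθinj n)
    · refine (hfin.2.preimage (f := sigmaMap θ.toFun) ?_).subset ?_
      · rintro ⟨n, x⟩ - ⟨m, y⟩ - e
        obtain ⟨rfl, e⟩ := Sigma.mk.inj e
        exact congrArg (Sigma.mk n) (hθinj n (eq_of_heq e))
      · rintro ⟨n, x⟩ hx
        obtain ⟨a, ha, e⟩ := hgen n x hx
        change θ.toFun n x ∈ X.A n
        rwa [hθ n x a e]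
  refine hV.quotient_mem _ hlim X hX θ fun n => Set.Subset.antisymm ?_ ?_
  · rintro _ ⟨x, hx, rfl⟩
    obtain ⟨a, ha, e⟩ := hgen n x hx
    rwa [hθ n x a e]
  · intro a ha
    have hA : ∀ j, ((toTowerLimit η hη).toFun n a).1 j ∈ (R j).A n := fun j => ⟨a, ha, rfl⟩
    exact ⟨⟨_, SubPreclone.subset_generated _ _ n hA⟩, hA, hθ n _ a rfl⟩

/-! ### Restricted block products as subdirect products -/

namespace PrecloneData

variable {S T T' : PrecloneData.{u}} {k m n : ℕ}

theorem finite_tup {El : ℕ → Type u} (h : ∀ r, Finite (El r)) (n m : ℕ) :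
    Finite (Tup El n m) := by
  have hle : ∀ (g : Tup El n m) (i : Fin n), (g.get i).1 < m + 1 := fun g i => by
    have := g.before_add_after i
    omega
  refine Finite.of_injective
    (fun (g : Tup El n m) (i : Fin n) =>
      (⟨⟨(g.get i).1, hle g i⟩, (g.get i).2⟩ : Σ r : Fin (m + 1), El r)) fun g h e => ?_
  ext1
  apply List.ext_getElem
  · rw [g.length_eq, h.length_eq]
  · intro i h1 h2
    have hi : i < n := by rwa [g.length_eq] at h1
    exact congrArg (fun x : Σ r : Fin (m + 1), El r => (⟨x.1, x.2⟩ : Σ r, El r))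
      (congrFun e ⟨i, hi⟩)

theorem IsFinitary.finite_context (hT : T.IsFinitary) (k n : ℕ) : Finite (Context T k n) := by
  have : ∀ r, Finite (T.El r) := hT
  have := finite_tup (El := T.El) hT
  refine Finite.of_injective
    (fun C : Context T k n =>
      (⟨(⟨C.k₁, by have := C.rank_eq; omega⟩, ⟨C.ℓ, by have := C.rank_eq; omega⟩,
        ⟨C.k₂, by have := C.rank_eq; omega⟩), C.u, C.v⟩ :
        Σ r : Fin (k + 1) × Fin (k + 1) × Fin (k + 1),
          T.El (r.1 + 1 + r.2.2) × Tup T.El n r.2.1)) fun C D e => Context.raw_injective ?_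
  exact congrArg (fun x : Σ r : Fin (k + 1) × Fin (k + 1) × Fin (k + 1),
    T.El (r.1 + 1 + r.2.2) × Tup T.El n r.2.1 =>
      ((x.1.1 : ℕ), (x.1.2.2 : ℕ), (⟨_, x.2.1⟩ : Σ r, T.El r), x.2.2.list)) e

theorem IsFinitary.block (hS : S.IsFinitary) (hT : T.IsFinitary) (k : ℕ) :
    (S.block T k).IsFinitary := fun n => by
  have := hS n
  have := hT n
  have := hT.finite_context k n
  exact inferInstanceAs (Finite ((Context T k n → S.El n) × T.El n))

theorem Context.raw_plug_congr (φ : PrecloneHom T T') (C : Context T' k m) {n' : ℕ} (e : n = n')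
    {D : Context T m n} {D' : Context T m n'} (h : D.raw = D'.raw) :
    (C.plug φ D).raw = (C.plug φ D').raw := by
  subst e
  rw [Context.raw_injective h]

/-- Each context `C ∈ I_{k,m}(T')` induces a morphism `S □_k^{T'} T → S □_m T`, which takes `(F, g)`
to `(F(C ∘ _), g)`. -/
def restrictedBlockHom (hT' : T'.IsPreclone) (T : SubPreclone T') (C : Context T' k m) :
    PrecloneHom (S.restrictedBlock T' T k).toPreclone (S.block T.toPreclone m) where
  toFun n x := (fun D => x.1.1 (C.plug T.subtype D), ⟨x.1.2, x.2⟩)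
  map_one := rfl
  map_comp {n p} F G := by
    let ψ : ∀ r, (S.restrictedBlock T' T k).toPreclone.El r → BlockEl S T.toPreclone m r :=
      fun r x => (fun D => x.1.1 (C.plug T.subtype D), ⟨x.1.2, x.2⟩)
    let Gψ : Tup (BlockEl S T.toPreclone m) n p := G.map ψ
    let G' : Tup (BlockEl S T' k) n p := G.map fun _ x => x.1
    have hG : (Gψ.map fun _ x => x.2).map T.subtype.toFun = G'.map fun _ x => x.2 :=
      (congrArg (fun g : Tup T.toPreclone.El n p => g.map T.subtype.toFun)
        (Tup.map_map ψ (fun _ x => x.2) G)).trans ((Tup.map_map _ _ G).trans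
          (Tup.map_map (fun _ x => x.1) (fun _ x => x.2) G).symm)
    refine Prod.ext (funext fun D => ?_) (Subtype.ext ?_)
    · refine eq_of_heq (Sigma.mk.inj (?_ : (⟨p, _⟩ : Σ r, S.El r) = ⟨p, _⟩)).2
      refine (block_comp_fst F.1 G' (C.plug T.subtype D)).trans (Eq.trans ?_
        (block_comp_fst (ψ n F) Gψ D).symm)
      congr 1
      · refine congrArg (fun E => (⟨n, F.1.1 E⟩ : Σ r, S.El r)) ?_
        exact ((C.plug_absorb hT' T.subtype D _).trans (congrArg _ hG)).symm
      · congr 1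
        funext i
        have hi : i.1 < G.list.length := by rw [G.length_eq]; exact i.2
        have e1 : Gψ.get i = ⟨(G.get i).1, ψ _ (G.get i).2⟩ :=
          List.getElem_map (l := G.list) (sigmaMap ψ) (h := by simpa using hi)
        have e2 : (⟨(G.get i).1, (G.get i).2.1⟩ : Σ r, BlockEl S T' k r) = G'.get i :=
          (List.getElem_map (l := G.list) (fun x => (⟨x.1, x.2.1⟩ : Σ r, BlockEl S T' k r))
            (h := by simpa using hi)).symm
        obtain ⟨D', hD', h⟩ :=
          Context.exists_sigma_apply_eq e1 (D.inner (⟨F.1.2, F.2⟩ : T.toPreclone.El n) Gψ i)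
        refine Eq.trans ?_ h.symm
        refine (Context.sigma_apply_congr e2 ?_).symm
        refine (Context.raw_plug_congr T.subtype C (congrArg Sigma.fst e1).symm hD').trans ?_
        exact Context.raw_plug_inner hT' T.subtype C D _ Gψ G' hG i
    · exact congrArg (T'.comp F.1.2) hG.symm

/-- The morphisms induced by all contexts separate the elements of a restricted block product:
plugging the identity context into `C` gives `C`. -/
theorem restrictedBlockHom_separating (hT' : T'.IsPreclone) (T : SubPreclone T')
    (x y : (S.restrictedBlock T' T k).toPreclone.El n)
    (h : ∀ m (C : Context T' k m), (restrictedBlockHom hT' T C).toFun n x =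
      (restrictedBlockHom (S := S) hT' T C).toFun n y) : x = y := by
  refine Subtype.ext (Prod.ext (funext fun C => ?_)
    (congrArg (fun z => z.2.1) (h k (Context.identity T' k))))
  have h1 := congrFun (congrArg Prod.fst (h n C)) (Context.identity T.toPreclone n)
  change x.1.1 (C.plug T.subtype _) = y.1.1 (C.plug T.subtype _) at h1
  rwa [C.plug_identity hT' T.subtype] at h1

/-- The contexts of all arities `m` can be enumerated, since there are finitely many for each `m`. -/
theorem IsFinitary.exists_context_enumeration (hT : T.IsFinitary) (k : ℕ) :
    ∃ c : ℕ → Σ m, Context T k m, Function.Surjective c := by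
  have := hT.finite_context k
  have : Nonempty (Σ m, Context T k m) := ⟨⟨k, Context.identity T k⟩⟩
  exact exists_surjective_nat _

end PrecloneData

open PrecloneData

theorem IsClosedPseudovariety.restrictedBlock_mem {V : Set PrecloneData.{u}}
    (hV : IsClosedPseudovariety V) {S : PrecloneData.{u}} (hS : S ∈ V) {T' : PrecloneData.{u}}
    (hT' : T'.IsPreclone) (hfin : T'.IsFinitary) {T : SubPreclone T'} (hT : T.toPreclone ∈ V)
    (k : ℕ) : (S.restrictedBlock T' T k).toPreclone ∈ V := by
  obtain ⟨c, hc⟩ := hfin.exists_context_enumeration k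
  refine hV.toIsPseudovariety.mem_of_separating
    (SubPreclone.isPreclone ((hV.isPreclone S hS).block hT' k) _) (fun n => ?_)
    (fun i => hV.block_mem S hS _ hT (c i).1) (fun i => restrictedBlockHom hT' T (c i).2)
    fun n x y h => restrictedBlockHom_separating hT' T x y fun m C => ?_
  · have := (hV.isFinitary S hS).block hfin k n
    exact Subtype.finite
  · obtain ⟨i, hi⟩ := hc ⟨m, C⟩
    have := h i
    rw [hi] at this
    exact this

namespace PGData

variable (P : PGData.{u}) {Q' : PGData.{u}} (hQ' : Q'.S.IsPreclone)
  (B : ∀ n, Set (Q'.S.El n)) {k m : ℕ} (hX : (P.restrictedBlock Q' B k).IsPGPair)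

/-- The underlying preclone of `(S, A) □_k^{(T', B')} (T, B)` is contained in `S □_k^{T'} T`. -/
def restrictedBlockInclusion : PrecloneHom (P.restrictedBlock Q' B k).S
    (P.S.restrictedBlock Q'.S (SubPreclone.generated Q'.S B) k).toPreclone :=
  ((SubPreclone.subtype _).comp (SubPreclone.subtype _)).codRestrict _ fun n x =>
    hX.2 n x (SubPreclone.comap ((SubPreclone.subtype _).comp (SubPreclone.subtype _))
      (P.S.restrictedBlock Q'.S (SubPreclone.generated Q'.S B) k))
      fun r _ hy => SubPreclone.subset_generated Q'.S B r hy.2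

theorem restrictedBlockInclusion_injective (n : ℕ) :
    Function.Injective ((P.restrictedBlockInclusion B hX).toFun n) := fun _ _ e =>
  have h := congrArg Subtype.val e
  Subtype.ext (Subtype.ext h)

/-- The induced morphisms take generators `(F, g)`, with `g ∈ B` and values of `F` in `A`, to pairs
of the same kind. -/
theorem restrictedBlockHom_mem_blockGen (C : Context Q'.S k m) (n : ℕ) :
    ∀ x ∈ (P.restrictedBlock Q' B k).A n,
      ((restrictedBlockHom hQ' _ C).comp (P.restrictedBlockInclusion B hX)).toFun n x ∈
        P.blockGen (generated Q'.S B).S (generated Q'.S B).A m n :=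
  fun _ hx => ⟨hx.2, fun D => hx.1.2 (C.plug (SubPreclone.subtype _) D)⟩

/-- The morphism from `(S, A) □_k^{(T', B')} (T, B)` to `(S, A) □_m (T, B)` induced by a context
`C ∈ I_{k,m}(T')`. -/
def restrictedBlockToBlock (C : Context Q'.S k m) :
    PrecloneHom (P.restrictedBlock Q' B k).S (P.block (generated Q'.S B) m).S :=
  ((restrictedBlockHom hQ' _ C).comp (P.restrictedBlockInclusion B hX)).codRestrict _
    (hX.map_mem_generated _ (P.restrictedBlockHom_mem_blockGen hQ' B hX C))

theorem IsPGPair.block {P Q : PGData.{u}} (hP : P.IsPGPair) (hQ : Q.IsPGPair) (k : ℕ) :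
    (P.block Q k).IsPGPair :=
  isPGPair_generated (hP.1.block hQ.1 k) _

theorem isFinitary_restrictedBlock {P : PGData.{u}} (hP : P.IsFinitary) (hQ : Q'.IsFinitary)
    (hB : ∀ n, B n ⊆ Q'.A n) (k : ℕ) : (P.restrictedBlock Q' B k).IsFinitary := by
  have hfin : (P.restrictedBlock Q' B k).S.IsFinitary := fun n =>
    have := hP.1.block hQ.1 k n
    Finite.of_injective (fun x : (P.restrictedBlock Q' B k).S.El n => x.1.1)
      fun _ _ e => Subtype.ext (Subtype.ext e)
  refine ⟨hfin, ?_⟩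
  -- The ranks of the generators are among the finitely many ranks of the generators of `Q'`.
  refine ((hQ.2.image Sigma.fst).biUnion fun n _ =>
    have := hfin n
    Set.finite_range (Sigma.mk n)).subset ?_
  rintro ⟨n, x⟩ hx
  have hn : n ∈ Sigma.fst '' {x : Σ n, Q'.S.El n | x.2 ∈ Q'.A x.1} :=
    ⟨⟨n, x.1.1.2⟩, hB n hx.2, rfl⟩
  exact Set.mem_biUnion hn ⟨x, rfl⟩

end PGData

theorem IsClosedPGPseudovariety.restrictedBlock_mem {V : Set PGData.{u}}
    (hV : IsClosedPGPseudovariety V) {P : PGData.{u}} (hP : P ∈ V) {Q' : PGData.{u}}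
    (hQ' : Q'.IsPGPair) (hfin : Q'.IsFinitary) {B : ∀ n, Set (Q'.S.El n)}
    (hB : ∀ n, B n ⊆ Q'.A n) (hT : PGData.generated Q'.S B ∈ V) (k : ℕ) :
    P.restrictedBlock Q' B k ∈ V := by
  obtain ⟨c, hc⟩ := hfin.1.exists_context_enumeration k
  have hX : (P.restrictedBlock Q' B k).IsPGPair :=
    PGData.isPGPair_generated ((hV.isPGPair P hP).block hQ' k).1 _
  refine hV.toIsPGPseudovariety.mem_of_separating hX
    (PGData.isFinitary_restrictedBlock B (hV.isFinitary P hP) hfin hB k)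
    (fun i => hV.block_mem P hP _ hT (c i).1)
    (fun i => P.restrictedBlockToBlock hQ'.1 B hX (c i).2)
    (fun i => P.restrictedBlockHom_mem_blockGen hQ'.1 B hX (c i).2)
    fun n x y h => P.restrictedBlockInclusion_injective B hX n
      (restrictedBlockHom_separating hQ'.1 _ _ _ fun m C => ?_)
  obtain ⟨i, hi⟩ := hc ⟨m, C⟩
  have := h i
  rw [hi] at this
  exact congrArg Subtype.val this

theorem mainTheorem8 :
    (∀ S T : PrecloneData.{u}, S.IsPreclone → T.IsPreclone → ∀ k : ℕ, (S.block T k).IsPreclone) ∧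
    (∀ V : Set PrecloneData.{u}, IsClosedPseudovariety V →
      ∀ S ∈ V, ∀ T' : PrecloneData.{u}, T'.IsPreclone → T'.IsFinitary →
      ∀ T : SubPreclone T', T.toPreclone ∈ V →
      ∀ k : ℕ, (S.restrictedBlock T' T k).toPreclone ∈ V) ∧
    (∀ P Q : PGData.{u}, P.IsPGPair → Q.IsPGPair → ∀ k : ℕ, (P.block Q k).IsPGPair) ∧
    (∀ V : Set PGData.{u}, IsClosedPGPseudovariety V →
      ∀ P ∈ V, ∀ Q' : PGData.{u}, Q'.IsPGPair → Q'.IsFinitary →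
      ∀ B : (n : ℕ) → Set (Q'.S.El n), (∀ n, B n ⊆ Q'.A n) → PGData.generated Q'.S B ∈ V →
      ∀ k : ℕ, P.restrictedBlock Q' B k ∈ V) := by
  exact ⟨fun S T hS hT k => hS.block hT k,
    fun V hV S hS T' hT' hfin T hT k => hV.restrictedBlock_mem hS hT' hfin hT k,
    fun P Q hP hQ k => hP.block hQ k,
    fun V hV P hP Q' hQ' hfin B hB hT k => hV.restrictedBlock_mem hP hQ' hfin hB hT k⟩
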